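/- Let $n\in\mathbb N$, let $a<b$ be real numbers, and put $\mathcal J=\begin{pmatrix}0&I\\-I&0\end{pmatrix}\in\mathbb R^{2n\times 2n}$, $E=\begin{pmatrix}0\\I\end{pmatrix}\in\mathbb R^{2n\times n}$. A real $2n\times 2n$ matrix $S$ is symplectic if $S^T\mathcal JS=\mathcal J$. A Lagrangian plane is a matrix $C\in\mathbb R^{2n\times n}$ with $C^T\mathcal JC=0$ and $\operatorname{rank}C=n$; a continuous Lagrangian path on $[a,b]$ is a continuous function whose values are Lagrangian planes. For $Y=\begin{pmatrix}X\\U\end{pmatrix}$ and $\hat Y=\begin{pmatrix}\hat X\\\hat U\end{pmatrix}$ with $n\times n$ blocks let $W(Y,\hat Y)=Y^T\mathcal J\hat Y$. For Lagrangian planes $Y,\hat Y$ the comparative index and the dual comparative index are $$\mu(Y,\hat Y)=\operatorname{rank}\mathcal M+\operatorname{ind}\mathcal P,\qquad \mu^*(Y,\hat Y)=\operatorname{rank}\mathcal M+\operatorname{ind}(-\mathcal P),$$ where $\mathcal M=(I-X^\dagger X)W(Y,\hat Y)$, $V=I-\mathcal M^\dagger\mathcal M$, $\mathcal P=V\,W(Y,\hat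 Y)^TX^\dagger\hat X\,V$, $\dagger$ is the Moore--Penrose pseudoinverse, and $\operatorname{ind}$ is the number of negative eigenvalues (with multiplicity) of a symmetric matrix. Let $Y$ be a continuous Lagrangian path on $[a,b]$. Call a partition $a=t_0<t_1<\dots<t_p=b$ together with symplectic-matrix-valued functions $R_0,\dots,R_{p-1}$ admissible for $Y$ if, for every $k$, $R_k$ is continuous on $[t_k,t_{k+1}]$ and both $\operatorname{rank}W(R_k(t)E,Y(t))$ and the rank of the upper $n\times n$ block of $R_k(t)E$ are constant on $[t_k,t_{k+1}]$. The oscillation number and the dual oscillation number of $Y$ on $[a,b]$ are $$\mathcal N(Y)=\sum_{k=0}^{p-1}\big[\mu(Y(t_{k+1}),R_k(t_{k+1})E)-\mu(Y(t_k),R_k(t_k)E)\big],$$ $$\mathcal N^*(Y)=\sum_{k=0}^{p-1}\big[\mu^*(Y(t_k),R_k(t_k)E)-\mu^*(Y(t_{k+1}),R_k(t_{k+1})E)\big],$$ computed from an admissible system. **Theorem.** Let $\Phi:[a,b]\to\mathbb R^{2n\times 2n}$ be continuous with symplectic values, and let $Y,\hat Y\in\mathcal F(\Phi)$, that is, $Y(t)=\Phi(t)C$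 and $\hat Y(t)=\Phi(t)\hat C$ on $[a,b]$ for some (constant) Lagrangian planes $C,\hat C$. Then the oscillation numbers and dual oscillation numbers of $Y$ and $\hat Y$ are well defined (admissible systems exist, and all of them give the same values), and $$\mathcal N(Y)-\mathcal N(\hat Y)=\mu(Y(b),\hat Y(b))-\mu(Y(a),\hat Y(a)),$$ $$\mathcal N^*(Y)-\mathcal N^*(\hat Y)=\mu^*(Y(a),\hat Y(a))-\mu^*(Y(b),\hat Y(b)).$$ -/

import Mathlib

/-! Comparative index and oscillation numbers of continuous Lagrangian paths. -/

noncomputable section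

namespace LagrangianPath

open Matrix

/-- The canonical skew-symmetric `2n × 2n` matrix with block rows `(0, I)` and `(-I, 0)`.
This is minus Mathlib's `Matrix.J`, so the symplectic group is the same. -/
def canonJ (n : ℕ) : Matrix (Fin n ⊕ Fin n) (Fin n ⊕ Fin n) ℝ :=
  Matrix.fromBlocks 0 1 (-1) 0

/-- The vertical Lagrangian plane `E = (0, I)ᵀ`. -/
def vertE (n : ℕ) : Matrix (Fin n ⊕ Fin n) (Fin n) ℝ :=
  Matrix.fromRows 0 1

/-- `Y` is a Lagrangian plane: `Yᵀ J Y = 0` and `rank Y = n`. -/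
def IsLagrangian {n : ℕ} (Y : Matrix (Fin n ⊕ Fin n) (Fin n) ℝ) : Prop :=
  Yᵀ * canonJ n * Y = 0 ∧ Y.rank = n

/-- The Wronskian `W(Y, Z) = Yᵀ J Z`. -/
def wronskian {n : ℕ} (Y Z : Matrix (Fin n ⊕ Fin n) (Fin n) ℝ) : Matrix (Fin n) (Fin n) ℝ :=
  Yᵀ * canonJ n * Z

/-- The four Penrose equations: `B` is the Moore-Penrose pseudoinverse of the real matrix `A`. -/
structure IsMoorePenrose {m n : ℕ} (A : Matrix (Fin m) (Fin n) ℝ)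
    (B : Matrix (Fin n) (Fin m) ℝ) : Prop where
  mul_mul_left : A * B * A = A
  mul_mul_right : B * A * B = B
  symm_left : (A * B)ᵀ = A * B
  symm_right : (B * A)ᵀ = B * A

theorem exists_isMoorePenrose {m n : ℕ} (A : Matrix (Fin m) (Fin n) ℝ) :
    ∃ B, IsMoorePenrose A B := by
  have hH : (Aᵀ * A).IsHermitian := by
    have h := Matrix.isHermitian_conjTranspose_mul_self A
    rwa [Matrix.conjTranspose_eq_transpose_of_trivial] at h
  obtain ⟨G, hG, h1, h2, h3⟩ : ∃ G : Matrix (Fin n) (Fin n) ℝ, Gᵀ = G ∧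
      (Aᵀ * A) * G * (Aᵀ * A) = Aᵀ * A ∧ G * (Aᵀ * A) * G = G ∧
      (G * (Aᵀ * A))ᵀ = G * (Aᵀ * A) := by
    set H := Aᵀ * A with hHdef
    set U : Matrix (Fin n) (Fin n) ℝ := (hH.eigenvectorUnitary : Matrix (Fin n) (Fin n) ℝ)
    set d := hH.eigenvalues
    have hUU : Uᵀ * U = 1 := by
      have h := Unitary.coe_star_mul_self hH.eigenvectorUnitary
      rwa [Matrix.star_eq_conjTranspose, Matrix.conjTranspose_eq_transpose_of_trivial] at h
    have hsp : H = U * diagonal d * Uᵀ := by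
      have h := hH.spectral_theorem
      rw [Unitary.conjStarAlgAut_apply, Matrix.star_eq_conjTranspose,
        Matrix.conjTranspose_eq_transpose_of_trivial] at h
      exact h
    have key : ∀ M N : Matrix (Fin n) (Fin n) ℝ,
        U * M * Uᵀ * (U * N * Uᵀ) = U * (M * N) * Uᵀ := by
      intro M N
      calc U * M * Uᵀ * (U * N * Uᵀ) = U * M * (Uᵀ * U) * N * Uᵀ := by
            simp only [Matrix.mul_assoc]
        _ = _ := by rw [hUU]; simp only [Matrix.mul_assoc, Matrix.one_mul]
    refine ⟨U * diagonal (fun i => (d i)⁻¹) * Uᵀ, ?_, ?_, ?_, ?_⟩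
    · simp [Matrix.transpose_mul, Matrix.mul_assoc]
    · rw [hsp, key, key, diagonal_mul_diagonal, diagonal_mul_diagonal]
      simp
    · rw [hsp, key, key, diagonal_mul_diagonal, diagonal_mul_diagonal]
      congr 3
      funext i
      by_cases h : d i = 0 <;> simp [h]
    · rw [hsp, key, diagonal_mul_diagonal]
      simp [Matrix.transpose_mul, Matrix.mul_assoc]
  have hz : A * (G * (Aᵀ * A) - 1) = 0 := by
    rw [← Matrix.conjTranspose_mul_self_eq_zero, Matrix.conjTranspose_eq_transpose_of_trivial,
      Matrix.transpose_mul]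
    calc (G * (Aᵀ * A) - 1)ᵀ * Aᵀ * (A * (G * (Aᵀ * A) - 1))
        = (G * (Aᵀ * A) - 1)ᵀ * ((Aᵀ * A) * G * (Aᵀ * A) - Aᵀ * A) := by
          simp only [Matrix.mul_sub, Matrix.mul_assoc, Matrix.mul_one]
      _ = 0 := by rw [h1, sub_self, Matrix.mul_zero]
  rw [Matrix.mul_sub, Matrix.mul_one, sub_eq_zero] at hz
  refine ⟨G * Aᵀ, ?_, ?_, ?_, ?_⟩
  · simpa only [Matrix.mul_assoc] using hz
  · calc G * Aᵀ * A * (G * Aᵀ) = G * (Aᵀ * A) * G * Aᵀ := by simp only [Matrix.mul_assoc]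
      _ = G * Aᵀ := by rw [h2]
  · simp [Matrix.transpose_mul, hG, Matrix.mul_assoc]
  · simpa only [Matrix.mul_assoc] using h3

theorem IsMoorePenrose.unique {m n : ℕ} {A : Matrix (Fin m) (Fin n) ℝ}
    {B C : Matrix (Fin n) (Fin m) ℝ} (hB : IsMoorePenrose A B) (hC : IsMoorePenrose A C) :
    B = C := by
  have h1 : A * B = A * C := by
    calc A * B = (A * B)ᵀ := hB.symm_left.symm
      _ = ((A * C) * (A * B))ᵀ := by rw [← Matrix.mul_assoc, hC.mul_mul_left]
      _ = (A * B)ᵀ * (A * C)ᵀ := Matrix.transpose_mul _ _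
      _ = A * B * (A * C) := by rw [hB.symm_left, hC.symm_left]
      _ = A * C := by rw [← Matrix.mul_assoc, hB.mul_mul_left]
  have h2 : B * A = C * A := by
    calc B * A = (B * A)ᵀ := hB.symm_right.symm
      _ = ((B * A) * (C * A))ᵀ := by
          rw [Matrix.mul_assoc, ← Matrix.mul_assoc A, hC.mul_mul_left]
      _ = (C * A)ᵀ * (B * A)ᵀ := Matrix.transpose_mul _ _
      _ = C * A * (B * A) := by rw [hB.symm_right, hC.symm_right]
      _ = C * A := by rw [Matrix.mul_assoc, ← Matrix.mul_assoc A, hB.mul_mul_left]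
  calc B = B * A * B := hB.mul_mul_right.symm
    _ = C * (A * C) := by rw [h2, Matrix.mul_assoc, h1]
    _ = C := by rw [← Matrix.mul_assoc, hC.mul_mul_right]

/-- The Moore-Penrose pseudoinverse `A†` of a real matrix. -/
def pinv {m n : ℕ} (A : Matrix (Fin m) (Fin n) ℝ) : Matrix (Fin n) (Fin m) ℝ :=
  Classical.choose (exists_isMoorePenrose A)

theorem pinv_spec {m n : ℕ} (A : Matrix (Fin m) (Fin n) ℝ) : IsMoorePenrose A (pinv A) :=
  Classical.choose_spec (exists_isMoorePenrose A)

/-- The number of negative eigenvalues, counted with multiplicity, of a (symmetric) matrix. -/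
def ind {n : ℕ} (P : Matrix (Fin n) (Fin n) ℝ) : ℕ :=
  Multiset.card (P.charpoly.roots.filter (fun x : ℝ => x < 0))

/-- The matrix `M = (I - X†X) W(Y, Z)`, where `X` is the upper block of `Y`. -/
def compM {n : ℕ} (Y Z : Matrix (Fin n ⊕ Fin n) (Fin n) ℝ) : Matrix (Fin n) (Fin n) ℝ :=
  (1 - pinv Y.toRows₁ * Y.toRows₁) * wronskian Y Z

/-- The matrix `V = I - M†M`. -/
def compV {n : ℕ} (Y Z : Matrix (Fin n ⊕ Fin n) (Fin n) ℝ) : Matrix (Fin n) (Fin n) ℝ :=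
  1 - pinv (compM Y Z) * compM Y Z

/-- The matrix `P = V W(Y, Z)ᵀ X† X̂ V`, where `X`, `X̂` are the upper blocks of `Y`, `Z`. -/
def compP {n : ℕ} (Y Z : Matrix (Fin n ⊕ Fin n) (Fin n) ℝ) : Matrix (Fin n) (Fin n) ℝ :=
  compV Y Z * (wronskian Y Z)ᵀ * pinv Y.toRows₁ * Z.toRows₁ * compV Y Z

/-- The comparative index `μ(Y, Z) = rank M + ind P`. -/
def compIndex {n : ℕ} (Y Z : Matrix (Fin n ⊕ Fin n) (Fin n) ℝ) : ℕ :=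
  (compM Y Z).rank + ind (compP Y Z)

/-- The dual comparative index `μ*(Y, Z) = rank M + ind (-P)`. -/
def dualCompIndex {n : ℕ} (Y Z : Matrix (Fin n ⊕ Fin n) (Fin n) ℝ) : ℕ :=
  (compM Y Z).rank + ind (-compP Y Z)

/-- Points `t 0, …, t p` and matrix functions `R 0, …, R (p - 1)` (the other values of `t` and
`R` are irrelevant). -/
structure OscSystem (n : ℕ) where
  p : ℕ
  t : ℕ → ℝ
  R : ℕ → ℝ → Matrix (Fin n ⊕ Fin n) (Fin n ⊕ Fin n) ℝ

/-- The points form a partition `a = t 0 < ⋯ < t p = b`, and on `[t k, t (k + 1)]` the matrix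
`R k` is symplectic and continuous, with `W(R k E, Y)` and the upper block of `R k E` of
constant rank. -/
structure OscSystem.Admissible {n : ℕ} (D : OscSystem n) (a b : ℝ)
    (Y : ℝ → Matrix (Fin n ⊕ Fin n) (Fin n) ℝ) : Prop where
  left : D.t 0 = a
  right : D.t D.p = b
  lt_succ : ∀ k < D.p, D.t k < D.t (k + 1)
  symplectic : ∀ k < D.p, ∀ s ∈ Set.Icc (D.t k) (D.t (k + 1)),
    D.R k s ∈ Matrix.symplecticGroup (Fin n) ℝ
  continuousOn : ∀ k < D.p, ContinuousOn (D.R k) (Set.Icc (D.t k) (D.t (k + 1)))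
  rank_wronskian : ∀ k < D.p, ∃ r : ℕ, ∀ s ∈ Set.Icc (D.t k) (D.t (k + 1)),
    (wronskian (D.R k s * vertE n) (Y s)).rank = r
  rank_upper : ∀ k < D.p, ∃ r : ℕ, ∀ s ∈ Set.Icc (D.t k) (D.t (k + 1)),
    (D.R k s * vertE n).toRows₁.rank = r

/-- `∑ₖ (μ(Y(tₖ₊₁), Rₖ(tₖ₊₁) E) - μ(Y(tₖ), Rₖ(tₖ) E))`. -/
def OscSystem.oscSum {n : ℕ} (D : OscSystem n)
    (Y : ℝ → Matrix (Fin n ⊕ Fin n) (Fin n) ℝ) : ℤ :=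
  ∑ k ∈ Finset.range D.p,
    ((compIndex (Y (D.t (k + 1))) (D.R k (D.t (k + 1)) * vertE n) : ℤ)
      - (compIndex (Y (D.t k)) (D.R k (D.t k) * vertE n) : ℤ))

/-- `∑ₖ (μ*(Y(tₖ), Rₖ(tₖ) E) - μ*(Y(tₖ₊₁), Rₖ(tₖ₊₁) E))`. -/
def OscSystem.dualOscSum {n : ℕ} (D : OscSystem n)
    (Y : ℝ → Matrix (Fin n ⊕ Fin n) (Fin n) ℝ) : ℤ :=
  ∑ k ∈ Finset.range D.p,
    ((dualCompIndex (Y (D.t k)) (D.R k (D.t k) * vertE n) : ℤ)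
      - (dualCompIndex (Y (D.t (k + 1))) (D.R k (D.t (k + 1)) * vertE n) : ℤ))

open Classical in
/-- The oscillation number `N(Y, [a, b])`: the value of `oscSum` for some admissible system. -/
def oscNumber {n : ℕ} (a b : ℝ) (Y : ℝ → Matrix (Fin n ⊕ Fin n) (Fin n) ℝ) : ℤ :=
  if h : ∃ D : OscSystem n, D.Admissible a b Y then h.choose.oscSum Y else 0

open Classical in
/-- The dual oscillation number `N*(Y, [a, b])`: the value of `dualOscSum` for some admissible
system. -/
def dualOscNumber {n : ℕ} (a b : ℝ) (Y : ℝ → Matrix (Fin n ⊕ Fin n) (Fin n) ℝ) : ℤ :=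
  if h : ∃ D : OscSystem n, D.Admissible a b Y then h.choose.dualOscSum Y else 0

/-- The oscillation numbers of `Y` on `[a, b]` are well defined: an admissible system exists,
and all admissible systems give the same values. -/
def OscWellDefined {n : ℕ} (a b : ℝ) (Y : ℝ → Matrix (Fin n ⊕ Fin n) (Fin n) ℝ) : Prop :=
  (∃ D : OscSystem n, D.Admissible a b Y) ∧
    ∀ D : OscSystem n, D.Admissible a b Y →
      D.oscSum Y = oscNumber a b Y ∧ D.dualOscSum Y = dualOscNumber a b Y

/-- The set `F(Φ)` of paths `t ↦ Φ(t) C` on `[a, b]` with a Lagrangian plane `C`. -/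
def pathFamily {n : ℕ} (a b : ℝ) (Φ : ℝ → Matrix (Fin n ⊕ Fin n) (Fin n ⊕ Fin n) ℝ) :
    Set (ℝ → Matrix (Fin n ⊕ Fin n) (Fin n) ℝ) :=
  {Y | ∃ C : Matrix (Fin n ⊕ Fin n) (Fin n) ℝ, IsLagrangian C ∧
    ∀ t ∈ Set.Icc a b, Y t = Φ t * C}

end LagrangianPath

end

/-! For all but finitely many real `s`, a Lagrangian plane `Y` is transversal to the plane `(I,
sI)`, and is then described by the symmetric matrix `A = X (U - sX)⁻¹`. If `A` and `B` are the
matrices of `Y` and `Z` in one such chart, then `μ(Y, Z) = ind (A - B) + ind B - ind A`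
(`signedIndex_chart`). This comes from computing the inertia of one block matrix twice: it is
congruent to `diag(B, A - B)`, and its generalized Schur complement with respect to a congruent copy
of `A` produces `rank M` and `P`.

The ranks of `A - B` and `B` are those of the Wronskian and of the upper block of `Z`. A symmetric
matrix varying continuously with constant rank has locally constant index, so wherever the Wronskian
has constant rank the increments of `μ(Y, Z)` are those of `ind B - ind A`. For an admissible frame
`Z = R E` the term `ind B` is constant as well, so `μ(Y, R E)` has the increments of `-ind A`,
whatever the frame. Glued over a partition, these functions form a primitive `F` with `F a = 0` and
`F b` equal to the oscillation sum (`exists_primitive`).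

For two paths with Wronskian of constant rank and primitives `F`, `G`, the integer function `F - G -
μ(Y, Z)` is locally constant, hence constant (`signedSum_sub_signedSum`). Taking `Z = Y` gives
independence of the admissible system; taking two paths moved by the same `Φ` gives the theorem. A
sign `ε = ±1` treats `μ` and `μ*` together. -/

namespace LagrangianPath

open Matrix Polynomial Filter Topology

/-- The number of negative roots of the characteristic polynomial, for an arbitrary finite index
type. For symmetric matrices this is the negative index of inertia. -/
noncomputable def negInd {ι : Type*} [Fintype ι] [DecidableEq ι] (A : Matrix ι ι ℝ) : ℕ :=
  Multiset.card (A.charpoly.roots.filter (fun x : ℝ => x < 0))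

/-! ### Negative index of inertia of real symmetric matrices. -/

section Inertia

set_option linter.unusedSectionVars false

variable {ι κ : Type*} [Fintype ι] [DecidableEq ι] [Fintype κ] [DecidableEq κ]

theorem isHermitian_of_transpose_eq {A : Matrix ι ι ℝ} (hA : Aᵀ = A) : A.IsHermitian := by
  rw [Matrix.IsHermitian, Matrix.conjTranspose_eq_transpose_of_trivial, hA]

theorem negInd_eq_card {A : Matrix ι ι ℝ} (hA : A.IsHermitian) :
    negInd A = Fintype.card {i // hA.eigenvalues i < 0} := by
  rw [negInd, hA.roots_charpoly_eq_eigenvalues, Multiset.filter_map, Multiset.card_map,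
    Fintype.card_subtype]
  rfl

theorem exists_orthogonal_diagonal {A : Matrix ι ι ℝ} (hA : A.IsHermitian) :
    ∃ U : Matrix ι ι ℝ, Uᵀ * U = 1 ∧ A = U * diagonal hA.eigenvalues * Uᵀ := by
  refine ⟨hA.eigenvectorUnitary, ?_, ?_⟩
  · have h := Unitary.coe_star_mul_self hA.eigenvectorUnitary
    rwa [Matrix.star_eq_conjTranspose, Matrix.conjTranspose_eq_transpose_of_trivial] at h
  · have h := hA.spectral_theorem
    rw [Unitary.conjStarAlgAut_apply, Matrix.star_eq_conjTranspose,
      Matrix.conjTranspose_eq_transpose_of_trivial] at h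
    exact h

theorem dotProduct_diagonal_mulVec (d v : ι → ℝ) :
    v ⬝ᵥ (diagonal d *ᵥ v) = ∑ i, d i * v i ^ 2 := by
  simp only [dotProduct, mulVec_diagonal]
  exact Finset.sum_congr rfl fun i _ => by ring

theorem dotProduct_congr_mulVec (A : Matrix ι ι ℝ) (B : Matrix ι κ ℝ) (v : κ → ℝ) :
    v ⬝ᵥ ((Bᵀ * A * B) *ᵥ v) = (B *ᵥ v) ⬝ᵥ (A *ᵥ (B *ᵥ v)) := by
  rw [← mulVec_mulVec, ← mulVec_mulVec, dotProduct_mulVec, vecMul_transpose]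

/-- Together with `exists_negDef` this is the variational description of the index as the largest
dimension of a negative definite subspace; congruence and semicontinuity statements follow from it.
-/
theorem card_le_negInd {A : Matrix ι ι ℝ} (hA : Aᵀ = A) (B : Matrix ι κ ℝ)
    (hB : ∀ v : κ → ℝ, v ≠ 0 → v ⬝ᵥ ((Bᵀ * A * B) *ᵥ v) < 0) :
    Fintype.card κ ≤ negInd A := by
  have hH := isHermitian_of_transpose_eq hA
  obtain ⟨U, -, hU⟩ := exists_orthogonal_diagonal hH
  rw [negInd_eq_card hH]
  -- The coordinates of `B v` along the negative eigenvectors. If all vanish, the form is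
  -- nonnegative at `B v`, which forces `v = 0`.
  let f : (κ → ℝ) →ₗ[ℝ] ({i // hH.eigenvalues i < 0} → ℝ) :=
    (LinearMap.funLeft ℝ ℝ Subtype.val).comp (Uᵀ * B).mulVecLin
  have hf : Function.Injective f := by
    rw [← LinearMap.ker_eq_bot, LinearMap.ker_eq_bot']
    intro v hv
    by_contra hne
    have h := hB v hne
    have h2 : v ⬝ᵥ ((Bᵀ * A * B) *ᵥ v) =
        ∑ i, hH.eigenvalues i * ((Uᵀ * B) *ᵥ v) i ^ 2 := by
      rw [← dotProduct_diagonal_mulVec, ← dotProduct_congr_mulVec]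
      congr 2
      conv_lhs => rw [hU]
      simp only [transpose_mul, transpose_transpose, Matrix.mul_assoc]
    rw [h2] at h
    refine absurd h (not_lt.mpr (Finset.sum_nonneg fun i _ => ?_))
    by_cases hi : hH.eigenvalues i < 0
    · have : ((Uᵀ * B) *ᵥ v) i = 0 := congrFun hv ⟨i, hi⟩
      simp [this]
    · exact mul_nonneg (not_lt.mp hi) (sq_nonneg _)
  simpa using LinearMap.finrank_le_finrank_of_injective hf

theorem exists_negDef {A : Matrix ι ι ℝ} (hA : Aᵀ = A) :
    ∃ B : Matrix ι (Fin (negInd A)) ℝ,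
      ∀ v : Fin (negInd A) → ℝ, v ≠ 0 → v ⬝ᵥ ((Bᵀ * A * B) *ᵥ v) < 0 := by
  have hH := isHermitian_of_transpose_eq hA
  obtain ⟨U, hUU, hU⟩ := exists_orthogonal_diagonal hH
  let e : Fin (negInd A) ≃ {i // hH.eigenvalues i < 0} :=
    (Fintype.equivFinOfCardEq (negInd_eq_card hH).symm).symm
  refine ⟨U.submatrix id (fun j => (e j : ι)), fun v hv => ?_⟩
  have hB : (U.submatrix id (fun j => (e j : ι)))ᵀ * A * U.submatrix id (fun j => (e j : ι)) =
      diagonal (fun j => hH.eigenvalues (e j)) := by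
    have h1 : Uᵀ * A * U = diagonal hH.eigenvalues := by
      conv_lhs => rw [hU]
      calc Uᵀ * (U * diagonal hH.eigenvalues * Uᵀ) * U
          = (Uᵀ * U) * diagonal hH.eigenvalues * (Uᵀ * U) := by simp only [Matrix.mul_assoc]
        _ = _ := by rw [hUU, Matrix.one_mul, Matrix.mul_one]
    have h2 : (U.submatrix id (fun j => (e j : ι)))ᵀ * A * U.submatrix id (fun j => (e j : ι)) =
        (Uᵀ * A * U).submatrix (fun j => (e j : ι)) (fun j => (e j : ι)) := by
      ext i j
      simp [Matrix.mul_apply]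
    rw [h2, h1]
    exact submatrix_diagonal _ _ (Subtype.val_injective.comp e.injective)
  rw [hB, dotProduct_diagonal_mulVec]
  obtain ⟨j, hj⟩ := Function.ne_iff.mp hv
  refine Finset.sum_neg' (fun i _ => ?_) ⟨j, Finset.mem_univ _, ?_⟩
  · exact mul_nonpos_of_nonpos_of_nonneg (e i).2.le (sq_nonneg _)
  · exact mul_neg_of_neg_of_pos (e j).2 (by have : v j ≠ 0 := hj; positivity)

theorem transpose_congr_eq {A : Matrix ι ι ℝ} (hA : Aᵀ = A) (B : Matrix ι κ ℝ) :
    (Bᵀ * A * B)ᵀ = Bᵀ * A * B := by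
  simp only [transpose_mul, transpose_transpose, hA, Matrix.mul_assoc]

theorem negInd_congr_le {A : Matrix ι ι ℝ} (hA : Aᵀ = A) (S : Matrix ι κ ℝ) :
    negInd (Sᵀ * A * S) ≤ negInd A := by
  obtain ⟨B, hB⟩ := exists_negDef (transpose_congr_eq hA S)
  have h := card_le_negInd hA (S * B) fun v hv => by
    have := hB v hv
    simpa only [transpose_mul, Matrix.mul_assoc] using this
  simpa using h

/-- Sylvester's law of inertia. -/
theorem negInd_congr {A : Matrix ι ι ℝ} (hA : Aᵀ = A) {S : Matrix ι ι ℝ} (hS : IsUnit S.det) :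
    negInd (Sᵀ * A * S) = negInd A := by
  refine le_antisymm (negInd_congr_le hA S) ?_
  have h := negInd_congr_le (transpose_congr_eq hA S) S⁻¹
  have h2 : S⁻¹ᵀ * (Sᵀ * A * S) * S⁻¹ = A := by
    have h3 : S⁻¹ᵀ * Sᵀ = 1 := by rw [← transpose_mul, mul_nonsing_inv _ hS, transpose_one]
    calc S⁻¹ᵀ * (Sᵀ * A * S) * S⁻¹ = (S⁻¹ᵀ * Sᵀ) * A * (S * S⁻¹) := by
          simp only [Matrix.mul_assoc]
      _ = A := by rw [h3, mul_nonsing_inv _ hS, Matrix.one_mul, Matrix.mul_one]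
  rwa [h2] at h

theorem negInd_neg {A : Matrix ι ι ℝ} (hA : A.IsHermitian) :
    negInd (-A) = Fintype.card {i // 0 < hA.eigenvalues i} := by
  obtain ⟨U, hUU, hU⟩ := exists_orthogonal_diagonal hA
  have hc : (-A).charpoly = (diagonal fun i => - hA.eigenvalues i).charpoly := by
    have h : -A = U * diagonal (fun i => - hA.eigenvalues i) * Uᵀ := by
      conv_lhs => rw [hU]
      rw [← diagonal_neg, Matrix.mul_neg, Matrix.neg_mul]
    rw [h, Matrix.charpoly_mul_comm, ← Matrix.mul_assoc, hUU, Matrix.one_mul]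
  rw [negInd, hc, charpoly_diagonal, Polynomial.roots_prod _ _
    (Finset.prod_ne_zero_iff.mpr fun i _ => X_sub_C_ne_zero _)]
  simp only [roots_X_sub_C, Multiset.bind_singleton]
  rw [Multiset.filter_map, Multiset.card_map, Fintype.card_subtype]
  simp only [Function.comp_def, Left.neg_neg_iff]
  rfl

theorem negInd_add_negInd_neg {A : Matrix ι ι ℝ} (hA : Aᵀ = A) :
    negInd A + negInd (-A) = A.rank := by
  have hH := isHermitian_of_transpose_eq hA
  rw [negInd_eq_card hH, negInd_neg hH, hH.rank_eq_card_non_zero_eigs,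
    ← Fintype.card_subtype_or_disjoint]
  · exact Fintype.card_congr (Equiv.subtypeEquivRight fun i => ne_iff_lt_or_gt.symm)
  · rw [Pi.disjoint_iff]
    intro i
    simp only [Prop.disjoint_iff]
    rintro ⟨h1, h2⟩
    exact lt_asymm h1 h2

/-- The negative index is lower semicontinuous. -/
theorem eventually_negInd_le {α : Type*} {l : Filter α} {A : α → Matrix ι ι ℝ}
    {A₀ : Matrix ι ι ℝ} (hA : ∀ᶠ t in l, (A t)ᵀ = A t) (hA₀ : A₀ᵀ = A₀)
    (hl : Tendsto A l (𝓝 A₀)) : ∀ᶠ t in l, negInd A₀ ≤ negInd (A t) := by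
  obtain ⟨B, hB⟩ := exists_negDef hA₀
  -- Compactness of the unit sphere makes negativity on the subspace an open condition on the
  -- matrix; homogeneity then extends it to all nonzero vectors.
  have key : ∀ᶠ C in 𝓝 A₀, ∀ v ∈ Metric.sphere (0 : Fin (negInd A₀) → ℝ) 1,
      v ⬝ᵥ ((Bᵀ * C * B) *ᵥ v) < 0 := by
    refine (isCompact_sphere _ _).eventually_forall_of_forall_eventually fun v hv => ?_
    have hcont : Continuous fun z : Matrix ι ι ℝ × (Fin (negInd A₀) → ℝ) =>
        z.2 ⬝ᵥ ((Bᵀ * z.1 * B) *ᵥ z.2) := by fun_prop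
    refine (hcont.tendsto (A₀, v)).eventually_lt_const (hB v ?_)
    rintro rfl
    simp at hv
  filter_upwards [hl.eventually key, hA] with t ht hAt
  have h := card_le_negInd hAt B fun v hv => by
    have hn : 0 < ‖v‖ := norm_pos_iff.mpr hv
    have h1 := ht (‖v‖⁻¹ • v) (by simp [norm_smul, hn.ne'])
    rw [mulVec_smul, dotProduct_smul, smul_dotProduct, smul_eq_mul, smul_eq_mul] at h1
    by_contra h2
    push Not at h2
    have : 0 ≤ ‖v‖⁻¹ * (‖v‖⁻¹ * (v ⬝ᵥ ((Bᵀ * A t * B) *ᵥ v))) := by positivity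
    linarith
  simpa using h

/-- A convergent family of symmetric matrices of the rank of its limit has eventually the
negative index of its limit. -/
theorem eventually_negInd_eq {α : Type*} {l : Filter α} {A : α → Matrix ι ι ℝ}
    {A₀ : Matrix ι ι ℝ} (hA : ∀ᶠ t in l, (A t)ᵀ = A t) (hA₀ : A₀ᵀ = A₀)
    (hl : Tendsto A l (𝓝 A₀)) (hr : ∀ᶠ t in l, (A t).rank = A₀.rank) :
    ∀ᶠ t in l, negInd (A t) = negInd A₀ := by
  have h2 := eventually_negInd_le (A := fun t => -A t) (hA.mono fun t ht => by simp [ht])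
    (by simp [hA₀]) hl.neg
  -- Neither index can drop in the limit's neighbourhood, and their sum, the rank, is fixed; so
  -- neither can grow.
  filter_upwards [eventually_negInd_le hA hA₀ hl, h2, hA, hr] with t h3 h4 h5 h6
  have h7 := negInd_add_negInd_neg h5
  have h8 := negInd_add_negInd_neg hA₀
  omega

/-- Since `G H = 0`, one has `(x - G)(x - H) = x (x - (G + H))`; take determinants. The extra power
of `x` adds only zero roots, so negative indices add. -/
theorem charpoly_mul_charpoly_of_mul_eq_zero {G H : Matrix ι ι ℝ} (h : G * H = 0) :
    G.charpoly * H.charpoly = X ^ Fintype.card ι * (G + H).charpoly := by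
  have hGH : G.map C * H.map C = (0 : Matrix ι ι ℝ[X]) := by
    rw [← Matrix.map_mul, h]; simp
  have hX : (X : ℝ[X]) ^ Fintype.card ι = (scalar ι (X : ℝ[X])).det := by simp
  rw [charpoly, charpoly, charpoly, ← det_mul, hX, ← det_mul]
  congr 1
  simp only [charmatrix, RingHom.mapMatrix_apply]
  rw [Matrix.sub_mul, Matrix.mul_sub, Matrix.mul_sub, hGH, Matrix.map_add _ (by simp)]
  rw [← (scalar_commute (X : ℝ[X]) (fun r => mul_comm _ r) (G.map C)).eq]
  rw [Matrix.mul_sub, Matrix.mul_add]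
  abel

theorem negInd_add_of_mul_eq_zero {G H : Matrix ι ι ℝ} (h : G * H = 0) :
    negInd (G + H) = negInd G + negInd H := by
  have h1 := congrArg Polynomial.roots (charpoly_mul_charpoly_of_mul_eq_zero h)
  rw [Polynomial.roots_mul (mul_ne_zero G.charpoly_monic.ne_zero H.charpoly_monic.ne_zero),
    Polynomial.roots_mul (mul_ne_zero (pow_ne_zero _ X_ne_zero) (G + H).charpoly_monic.ne_zero),
    Polynomial.roots_X_pow] at h1
  have h2 := congrArg (fun s => Multiset.card (Multiset.filter (fun x : ℝ => x < 0) s)) h1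
  simp only [Multiset.filter_add, Multiset.card_add] at h2
  have h3 : Multiset.filter (fun x : ℝ => x < 0) (Fintype.card ι • {0}) = 0 := by
    rw [Multiset.nsmul_singleton, Multiset.filter_eq_nil]
    intro x hx
    rw [Multiset.eq_of_mem_replicate hx]
    exact lt_irrefl _
  rw [h3] at h2
  simpa [negInd] using h2.symm

theorem negInd_fromBlocks_diagonal (G : Matrix ι ι ℝ) (D : Matrix κ κ ℝ) :
    negInd (fromBlocks G 0 0 D) = negInd G + negInd D := by
  rw [negInd, charpoly_fromBlocks_zero₁₂, Polynomial.roots_mul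
    (mul_ne_zero G.charpoly_monic.ne_zero D.charpoly_monic.ne_zero), Multiset.filter_add,
    Multiset.card_add]
  rfl

theorem rank_fromBlocks_diagonal {G : Matrix ι ι ℝ} {D : Matrix κ κ ℝ} (hG : Gᵀ = G)
    (hD : Dᵀ = D) : (fromBlocks G 0 0 D).rank = G.rank + D.rank := by
  rw [← negInd_add_negInd_neg hG, ← negInd_add_negInd_neg hD,
    ← negInd_add_negInd_neg (by simp [fromBlocks_transpose, hG, hD]), fromBlocks_neg]
  simp only [neg_zero, negInd_fromBlocks_diagonal]
  ring

/-- Congruence by `diag(1, -1)` turns the matrix into its negative, so both indices are half of its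
rank. The rank is `2 rank M`, as the square of the matrix is `diag(M Mᵀ, Mᵀ M)`. -/
theorem negInd_fromBlocks_offDiagonal (M : Matrix ι κ ℝ) :
    negInd (fromBlocks 0 M Mᵀ 0) = M.rank := by
  have hsymm : (fromBlocks 0 M Mᵀ 0)ᵀ = fromBlocks 0 M Mᵀ 0 := by
    simp [fromBlocks_transpose]
  have hflip : negInd (-fromBlocks 0 M Mᵀ 0) = negInd (fromBlocks 0 M Mᵀ 0) := by
    have h := negInd_congr hsymm (S := fromBlocks (1 : Matrix ι ι ℝ) 0 0 (-1 : Matrix κ κ ℝ))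
      (by rw [det_fromBlocks_zero₁₂]; simp [det_neg])
    rw [← h]
    congr 1
    simp [fromBlocks_transpose, fromBlocks_multiply, fromBlocks_neg]
  have hrank : (fromBlocks 0 M Mᵀ 0).rank = 2 * M.rank := by
    rw [← rank_transpose_mul_self, hsymm, fromBlocks_multiply]
    simp only [Matrix.zero_mul, Matrix.mul_zero, zero_add, add_zero]
    rw [rank_fromBlocks_diagonal (by simp) (by simp), rank_self_mul_transpose,
      rank_transpose_mul_self, two_mul]
  have := negInd_add_negInd_neg hsymm
  omega

end Inertia

end LagrangianPath

namespace LagrangianPath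

open Matrix Polynomial Filter Topology

/-! ### Inertia of block matrices with a singular corner. -/

section Schur

set_option linter.unusedSectionVars false

variable {ι κ : Type*} [Fintype ι] [DecidableEq ι] [Fintype κ] [DecidableEq κ]

theorem transpose_fromBlocks_symm {G : Matrix ι ι ℝ} {D : Matrix κ κ ℝ} (hG : Gᵀ = G)
    (hD : Dᵀ = D) (C : Matrix ι κ ℝ) : (fromBlocks G C Cᵀ D)ᵀ = fromBlocks G C Cᵀ D := by
  rw [fromBlocks_transpose, hG, hD, transpose_transpose]

theorem negInd_fromBlocks_shear {G : Matrix ι ι ℝ} {D : Matrix κ κ ℝ} (hG : Gᵀ = G)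
    (hD : Dᵀ = D) (C L : Matrix ι κ ℝ) :
    negInd (fromBlocks G C Cᵀ D) =
      negInd (fromBlocks G (C - G * L) (C - G * L)ᵀ (D - Lᵀ * C - Cᵀ * L + Lᵀ * G * L)) := by
  rw [← negInd_congr (transpose_fromBlocks_symm hG hD C) (S := fromBlocks 1 (-L) 0 1)
    (by rw [det_fromBlocks_zero₂₁]; simp)]
  congr 1
  rw [fromBlocks_transpose, fromBlocks_multiply, fromBlocks_multiply]
  congr 1
  · simp
  · simp [sub_eq_neg_add]
  · simp [hG, sub_eq_neg_add]
  · simp [Matrix.add_mul]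
    abel

/-- A shear along the range of `Nᵀ`, which `G` kills, reduces `D` to its compression by `1 - N M`.
The diagonal and off-diagonal parts then have product zero, and their indices add. -/
theorem negInd_fromBlocks_kernel {G : Matrix ι ι ℝ} {M : Matrix ι κ ℝ} {D : Matrix κ κ ℝ}
    {N : Matrix κ ι ℝ} (hG : Gᵀ = G) (hD : Dᵀ = D) (hGM : G * M = 0)
    (h1 : M * N * M = M) (h2 : N * M * N = N) (h3 : (M * N)ᵀ = M * N) (h4 : (N * M)ᵀ = N * M) :
    negInd (fromBlocks G M Mᵀ D) =
      negInd G + M.rank + negInd ((1 - N * M) * D * (1 - N * M)) := by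
  have hGN : G * Nᵀ = 0 := by
    have : Nᵀ = M * N * Nᵀ := by
      conv_lhs => rw [← h2, Matrix.mul_assoc, transpose_mul, h3]
    rw [this, ← Matrix.mul_assoc, ← Matrix.mul_assoc, hGM, Matrix.zero_mul, Matrix.zero_mul]
  have hMN : Mᵀ * Nᵀ = N * M := by rw [← transpose_mul, h4]
  have hM0 : M * (1 - N * M) = 0 := by
    rw [Matrix.mul_sub, Matrix.mul_one, ← Matrix.mul_assoc, h1, sub_self]
  have h0M : (1 - N * M) * Mᵀ = 0 := by
    rw [← h4, ← transpose_one, ← transpose_sub, ← transpose_mul, hM0, transpose_zero]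
  -- With `Q = N M`, the two mutually transposed cross terms must together change `D` to `D - DQ -
  -- QD + QDQ`; the factor `1 / 2` splits `QDQ` evenly between them.
  rw [negInd_fromBlocks_shear hG hD M (Nᵀ * (D - (1 / 2 : ℝ) • (D * (N * M))))]
  have hGL : G * (Nᵀ * (D - (1 / 2 : ℝ) • (D * (N * M)))) = 0 := by
    rw [← Matrix.mul_assoc, hGN, Matrix.zero_mul]
  have hcorner : D - (Nᵀ * (D - (1 / 2 : ℝ) • (D * (N * M))))ᵀ * M
      - Mᵀ * (Nᵀ * (D - (1 / 2 : ℝ) • (D * (N * M)))) = (1 - N * M) * D * (1 - N * M) := by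
    rw [← Matrix.mul_assoc Mᵀ, hMN, transpose_mul, transpose_transpose, Matrix.mul_assoc _ N M,
      transpose_sub, transpose_smul, transpose_mul D, h4, hD]
    simp only [Matrix.sub_mul, Matrix.mul_sub, Matrix.one_mul, Matrix.mul_one, Matrix.smul_mul,
      Matrix.mul_smul, Matrix.mul_assoc]
    module
  rw [Matrix.mul_assoc _ G, hGL, Matrix.mul_zero, add_zero, sub_zero, hcorner]
  have hsplit : fromBlocks G M Mᵀ ((1 - N * M) * D * (1 - N * M)) =
      fromBlocks G 0 0 ((1 - N * M) * D * (1 - N * M)) + fromBlocks 0 M Mᵀ 0 := by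
    simp [fromBlocks_add]
  rw [hsplit, negInd_add_of_mul_eq_zero, negInd_fromBlocks_diagonal,
    negInd_fromBlocks_offDiagonal]
  · ring
  · rw [fromBlocks_multiply, hGM, Matrix.mul_assoc _ _ Mᵀ, h0M]
    simp

/-- The inertia of a symmetric block matrix whose upper left block `G` may be singular. Here `Z`
solves `G Z = C` up to the part `M` of `C` in the kernel of `G`, and `N` is the pseudoinverse
of `M`. -/
theorem negInd_fromBlocks_schur {G : Matrix ι ι ℝ} {C M Z : Matrix ι κ ℝ} {D : Matrix κ κ ℝ}
    {N : Matrix κ ι ℝ} (hG : Gᵀ = G) (hD : Dᵀ = D) (hC : G * Z + M = C) (hGM : G * M = 0)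
    (h1 : M * N * M = M) (h2 : N * M * N = N) (h3 : (M * N)ᵀ = M * N) (h4 : (N * M)ᵀ = N * M) :
    negInd (fromBlocks G C Cᵀ D) =
      negInd G + M.rank + negInd ((1 - N * M) * (D - Zᵀ * G * Z) * (1 - N * M)) := by
  have hM0 : M * (1 - N * M) = 0 := by
    rw [Matrix.mul_sub, Matrix.mul_one, ← Matrix.mul_assoc, h1, sub_self]
  have h0M : (1 - N * M) * Mᵀ = 0 := by
    rw [← h4, ← transpose_one, ← transpose_sub, ← transpose_mul, hM0, transpose_zero]
  have hCGZ : C - G * Z = M := by rw [← hC, add_sub_cancel_left]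
  have hcorner : D - Zᵀ * C - Cᵀ * Z + Zᵀ * G * Z =
      D - Zᵀ * G * Z - Zᵀ * M - Mᵀ * Z := by
    rw [← hC]
    simp only [transpose_add, transpose_mul, hG, Matrix.mul_add, Matrix.add_mul, Matrix.mul_assoc]
    abel
  rw [negInd_fromBlocks_shear hG hD C Z, hCGZ, hcorner,
    negInd_fromBlocks_kernel hG _ hGM h1 h2 h3 h4]
  · congr 2
    rw [Matrix.mul_sub _ _ (Mᵀ * Z), ← Matrix.mul_assoc _ Mᵀ, h0M, Matrix.zero_mul, sub_zero,
      Matrix.mul_sub _ _ (Zᵀ * M), Matrix.sub_mul _ (_ * (Zᵀ * M)),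
      Matrix.mul_assoc _ (Zᵀ * M), Matrix.mul_assoc Zᵀ M, hM0]
    simp
  · simp only [transpose_sub, transpose_mul, transpose_transpose, hG, hD, Matrix.mul_assoc]
    abel

theorem rank_smul_of_mul_self {ε : ℝ} (hε : ε * ε = 1) (M : Matrix ι κ ℝ) :
    (ε • M).rank = M.rank := by
  have h : ε ≠ 0 := by rintro rfl; simp at hε
  have hM : ε • M = M * (ε • (1 : Matrix κ κ ℝ)) := by simp
  rw [hM, rank_mul_eq_left_of_isUnit_det]
  simp [h]

end Schur

/-! ### The comparative index expressed by symmetric matrices. -/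

section Index

variable {n : ℕ}

/-- The comparative index (`ε = 1`) and the dual comparative index (`ε = -1`). -/
noncomputable def signedIndex (ε : ℝ) (Y Z : Matrix (Fin n ⊕ Fin n) (Fin n) ℝ) : ℕ :=
  (compM Y Z).rank + negInd (ε • compP Y Z)

theorem signedIndex_one (Y Z : Matrix (Fin n ⊕ Fin n) (Fin n) ℝ) :
    signedIndex 1 Y Z = compIndex Y Z := by
  rw [signedIndex, one_smul]; rfl

theorem signedIndex_neg_one (Y Z : Matrix (Fin n ⊕ Fin n) (Fin n) ℝ) :
    signedIndex (-1) Y Z = dualCompIndex Y Z := by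
  rw [signedIndex, neg_smul, one_smul]; rfl

/-- The matrix `P` is a compression of a generalized Schur complement. -/
theorem compP_eq {Y Z : Matrix (Fin n ⊕ Fin n) (Fin n) ℝ} {A B K L : Matrix (Fin n) (Fin n) ℝ}
    (hK : IsUnit K.det) (hA : Aᵀ = A) (hB : Bᵀ = B) (hX : Y.toRows₁ = A * K)
    (hX' : Z.toRows₁ = B * L) (hW : wronskian Y Z = Kᵀ * (A - B) * L) :
    compP Y Z = compV Y Z *
      (Lᵀ * (A - B) * L - (K⁻¹ * (pinv Y.toRows₁)ᵀ * wronskian Y Z)ᵀ * (Kᵀ * A * K) *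
        (K⁻¹ * (pinv Y.toRows₁)ᵀ * wronskian Y Z)) * compV Y Z := by
  have hM1 := pinv_spec (compM Y Z)
  have hMV : compM Y Z * compV Y Z = 0 := by
    rw [compV, Matrix.mul_sub, Matrix.mul_one, ← Matrix.mul_assoc, hM1.mul_mul_left, sub_self]
  have hVT : (compV Y Z)ᵀ = compV Y Z := by
    rw [compV, transpose_sub, transpose_one, hM1.symm_right]
  rw [compP]
  rw [compM] at hMV
  set W := wronskian Y Z
  set X := Y.toRows₁
  set V := compV Y Z
  have hX1 := pinv_spec X
  set H := pinv X
  have hKK : K * K⁻¹ = 1 := mul_nonsing_inv _ hK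
  have hKT : K⁻¹ᵀ * Kᵀ = 1 := by rw [← transpose_mul, hKK, transpose_one]
  have hXT : Xᵀ = Kᵀ * A := by rw [hX, transpose_mul, hA]
  -- `M V = 0` allows the projection `X†X` to be inserted next to `W V`. After compression by `V`,
  -- `X†` thus acts as an inverse of `X` although `X` may be singular.
  have hWV : W * V = H * X * W * V := by
    rw [Matrix.sub_mul, Matrix.one_mul, Matrix.sub_mul, sub_eq_zero] at hMV
    exact hMV
  have hVW : V * Wᵀ = V * Wᵀ * (H * X) := by
    have h := congrArg transpose hWV
    rw [transpose_mul, Matrix.mul_assoc, transpose_mul (H * X), transpose_mul W, hX1.symm_right,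
      hVT] at h
    exact h
  have h1 : V * Wᵀ * H * (A * L) * V = V * (Lᵀ * (A - B) * L) * V := by
    calc V * Wᵀ * H * (A * L) * V = V * Wᵀ * H * (A * (K * K⁻¹) * L) * V := by
          rw [hKK, Matrix.mul_one]
      _ = V * Wᵀ * (H * X) * K⁻¹ * L * V := by rw [hX]; simp only [Matrix.mul_assoc]
      _ = V * (Lᵀ * (A - B) * (K * K⁻¹) * L) * V := by
          rw [← hVW, hW]
          simp only [transpose_mul, transpose_sub, hA, hB, transpose_transpose, Matrix.mul_assoc]
      _ = _ := by rw [hKK, Matrix.mul_one]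
  have h2 : (A - B) * L = K⁻¹ᵀ * W := by
    rw [hW, Matrix.mul_assoc, ← Matrix.mul_assoc, hKT, Matrix.one_mul]
  have h3 : V * Wᵀ * H * (K⁻¹ᵀ * W) * V = V * (Wᵀ * H * A * Hᵀ * W) * V := by
    calc V * Wᵀ * H * (K⁻¹ᵀ * W) * V = V * Wᵀ * H * K⁻¹ᵀ * (W * V) := by
          simp only [Matrix.mul_assoc]
      _ = V * Wᵀ * H * K⁻¹ᵀ * ((H * X)ᵀ * W * V) := by rw [hX1.symm_right, ← hWV]
      _ = V * Wᵀ * H * (K⁻¹ᵀ * Kᵀ) * A * Hᵀ * W * V := by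
          rw [transpose_mul, hXT]; simp only [Matrix.mul_assoc]
      _ = _ := by rw [hKT, Matrix.mul_one]; simp only [Matrix.mul_assoc]
  have h4 : (K⁻¹ * Hᵀ * W)ᵀ * (Kᵀ * A * K) * (K⁻¹ * Hᵀ * W) = Wᵀ * H * A * Hᵀ * W := by
    calc (K⁻¹ * Hᵀ * W)ᵀ * (Kᵀ * A * K) * (K⁻¹ * Hᵀ * W)
        = Wᵀ * H * (K⁻¹ᵀ * Kᵀ) * A * (K * K⁻¹) * Hᵀ * W := by
          simp only [transpose_mul, transpose_transpose, Matrix.mul_assoc]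
      _ = _ := by rw [hKT, hKK, Matrix.mul_one, Matrix.mul_one]
  have h5 : B * L = A * L - K⁻¹ᵀ * W := by rw [← h2, Matrix.sub_mul, sub_sub_cancel]
  rw [hX', h5, Matrix.mul_sub _ (A * L), Matrix.sub_mul _ _ V, h1, h3, h4,
    ← Matrix.sub_mul, ← Matrix.mul_sub]

/-- The comparative index of two planes in a chart in which they are the graphs of the symmetric
matrices `A` and `B`. -/
theorem signedIndex_add_negInd {ε : ℝ} (hε : ε * ε = 1)
    {Y Z : Matrix (Fin n ⊕ Fin n) (Fin n) ℝ} {A B K L : Matrix (Fin n) (Fin n) ℝ}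
    (hK : IsUnit K.det) (hL : IsUnit L.det) (hA : Aᵀ = A) (hB : Bᵀ = B)
    (hX : Y.toRows₁ = A * K) (hX' : Z.toRows₁ = B * L) (hW : wronskian Y Z = Kᵀ * (A - B) * L) :
    signedIndex ε Y Z + negInd (ε • A) = negInd (ε • (A - B)) + negInd (ε • B) := by
  set W := wronskian Y Z with hWdef
  set X := Y.toRows₁ with hXdef
  have hAB : (A - B)ᵀ = A - B := by rw [transpose_sub, hA, hB]
  have hX1 := pinv_spec X
  have hM1 := pinv_spec (compM Y Z)
  have hKK : K * K⁻¹ = 1 := mul_nonsing_inv _ hK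
  have hG : (Kᵀ * A * K)ᵀ = Kᵀ * A * K := transpose_congr_eq hA K
  have hGX : Kᵀ * A * K = Kᵀ * X := by rw [hX, Matrix.mul_assoc]
  have hGM : Kᵀ * A * K * compM Y Z = 0 := by
    rw [hGX, compM, Matrix.mul_assoc, ← Matrix.mul_assoc X, Matrix.mul_sub, ← hXdef,
      ← Matrix.mul_assoc X, hX1.mul_mul_left, Matrix.mul_one, sub_self, Matrix.zero_mul,
      Matrix.mul_zero]
  have hGZ : Kᵀ * A * K * (K⁻¹ * (pinv X)ᵀ * W) = pinv X * X * W := by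
    have hXT : Xᵀ = Kᵀ * A := by rw [hX, transpose_mul, hA]
    calc Kᵀ * A * K * (K⁻¹ * (pinv X)ᵀ * W) = Kᵀ * A * (K * K⁻¹) * (pinv X)ᵀ * W := by
          simp only [Matrix.mul_assoc]
      _ = (pinv X * X)ᵀ * W := by rw [hKK, Matrix.mul_one, ← hXT, ← transpose_mul]
      _ = _ := by rw [hX1.symm_right]
  have hC : Kᵀ * A * K * (K⁻¹ * (pinv X)ᵀ * W) + compM Y Z = W := by
    rw [hGZ, compM, Matrix.sub_mul, Matrix.one_mul, add_sub_cancel]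
  -- All blocks are scaled by `ε`. As `ε² = 1`, the pseudoinverse of `ε M` is `ε M†`, so the
  -- projection `1 - M†M` does not change.
  have hschur := negInd_fromBlocks_schur (G := ε • (Kᵀ * A * K)) (C := ε • W)
    (M := ε • compM Y Z) (Z := K⁻¹ * (pinv X)ᵀ * W) (D := ε • (Lᵀ * (A - B) * L))
    (N := ε • pinv (compM Y Z)) (by rw [transpose_smul, hG])
    (by rw [transpose_smul, transpose_congr_eq hAB]) (by rw [Matrix.smul_mul, ← smul_add, hC])
    (by rw [Matrix.smul_mul, Matrix.mul_smul, hGM, smul_zero, smul_zero])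
    (by simp only [Matrix.smul_mul, Matrix.mul_smul, smul_smul, hε, one_smul,
          hM1.mul_mul_left])
    (by simp only [Matrix.smul_mul, Matrix.mul_smul, smul_smul, hε, one_smul,
          hM1.mul_mul_right])
    (by simp only [Matrix.smul_mul, Matrix.mul_smul, smul_smul, hε, one_smul,
          hM1.symm_left])
    (by simp only [Matrix.smul_mul, Matrix.mul_smul, smul_smul, hε, one_smul,
          hM1.symm_right])
  rw [rank_smul_of_mul_self hε] at hschur
  have hP := compP_eq hK hA hB hX hX' hW
  have hcorner : (1 - (ε • pinv (compM Y Z)) * (ε • compM Y Z)) *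
      (ε • (Lᵀ * (A - B) * L) - (K⁻¹ * (pinv X)ᵀ * W)ᵀ * (ε • (Kᵀ * A * K)) *
        (K⁻¹ * (pinv X)ᵀ * W)) * (1 - (ε • pinv (compM Y Z)) * (ε • compM Y Z)) =
      ε • compP Y Z := by
    rw [hP, ← hXdef, ← hWdef]
    simp only [Matrix.smul_mul, Matrix.mul_smul, smul_smul, hε, one_smul, ← smul_sub, compV]
  rw [hcorner] at hschur
  have hAK : negInd (ε • (Kᵀ * A * K)) = negInd (ε • A) := by
    have h := negInd_congr (A := ε • A) (by rw [transpose_smul, hA]) hK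
    rwa [Matrix.mul_smul, Matrix.smul_mul] at h
  have hblock : negInd (fromBlocks (ε • (Kᵀ * A * K)) (ε • W) (ε • W)ᵀ (ε • (Lᵀ * (A - B) * L))) =
      negInd (ε • (A - B)) + negInd (ε • B) := by
    -- The lower left `K` adds `Kᵀ (A - B) K` to `Kᵀ B K`, giving the corner `Kᵀ A K`, and creates
    -- the off-diagonal block `Kᵀ (A - B) L = W`.
    have h := negInd_congr (A := fromBlocks (ε • B) 0 0 (ε • (A - B))) (S := fromBlocks K 0 K L)
      (by simp [fromBlocks_transpose, hA, hB])
      (by rw [det_fromBlocks_zero₁₂]; exact hK.mul hL)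
    rw [add_comm, ← negInd_fromBlocks_diagonal, ← h]
    congr 1
    rw [fromBlocks_transpose, fromBlocks_multiply, fromBlocks_multiply, hW]
    congr 1
    · simp only [Matrix.mul_smul, Matrix.smul_mul, Matrix.mul_zero, add_zero,
        zero_add, ← smul_add, ← Matrix.add_mul, ← Matrix.mul_add, add_sub_cancel]
    · simp
    · simp [transpose_mul, hA, hB, Matrix.mul_assoc]
    · simp
  rw [hblock, hAK] at hschur
  rw [hschur, signedIndex]
  ring

end Index
end LagrangianPath

namespace LagrangianPath

open Matrix Polynomial Filter Topology

/-! ### Charts of the Lagrangian Grassmannian and local behaviour of the index. -/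

section Chart

variable {n : ℕ}

theorem wronskian_eq (Y Z : Matrix (Fin n ⊕ Fin n) (Fin n) ℝ) :
    wronskian Y Z = Y.toRows₁ᵀ * Z.toRows₂ - Y.toRows₂ᵀ * Z.toRows₁ := by
  conv_lhs => rw [wronskian, canonJ, ← fromRows_toRows Y, ← fromRows_toRows Z]
  rw [transpose_fromRows, fromCols_mul_fromBlocks, fromCols_mul_fromRows]
  simp [sub_eq_neg_add]

theorem wronskian_swap (Y Z : Matrix (Fin n ⊕ Fin n) (Fin n) ℝ) :
    wronskian Z Y = -(wronskian Y Z)ᵀ := by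
  simp only [wronskian_eq, transpose_sub, transpose_mul, transpose_transpose, neg_sub]

theorem rank_neg_eq (M : Matrix (Fin n) (Fin n) ℝ) : (-M).rank = M.rank := by
  simpa using rank_smul_of_mul_self (ε := -1) (by norm_num) M

theorem rank_wronskian_swap (Y Z : Matrix (Fin n ⊕ Fin n) (Fin n) ℝ) :
    (wronskian Z Y).rank = (wronskian Y Z).rank := by
  rw [wronskian_swap Y Z, rank_neg_eq, rank_transpose]

theorem isUnit_det_of_rank_eq {M : Matrix (Fin n) (Fin n) ℝ} (h : M.rank = n) : IsUnit M.det := by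
  rw [← isUnit_iff_isUnit_det, ← mulVec_surjective_iff_isUnit]
  refine LinearMap.range_eq_top.mp (Submodule.eq_top_of_finrank_eq (S := M.mulVecLin.range) ?_)
  rw [Module.finrank_fintype_fun_eq_card, Fintype.card_fin]
  exact h

theorem IsLagrangian.isUnit_det {Y : Matrix (Fin n ⊕ Fin n) (Fin n) ℝ} (hY : IsLagrangian Y) :
    IsUnit (Yᵀ * Y).det :=
  isUnit_det_of_rank_eq (by rw [rank_transpose_mul_self, hY.2])

theorem IsLagrangian.transpose_mul_eq {Y : Matrix (Fin n ⊕ Fin n) (Fin n) ℝ}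
    (hY : IsLagrangian Y) : Y.toRows₁ᵀ * Y.toRows₂ = Y.toRows₂ᵀ * Y.toRows₁ := by
  have h : wronskian Y Y = 0 := hY.1
  rwa [wronskian_eq, sub_eq_zero] at h

/-- The Wronskian of the plane `(I, sI)` with `Y`. -/
def chartDenom (s : ℝ) (Y : Matrix (Fin n ⊕ Fin n) (Fin n) ℝ) : Matrix (Fin n) (Fin n) ℝ :=
  Y.toRows₂ - s • Y.toRows₁

/-- The symmetric matrix of the Lagrangian plane `Y` in the chart of all planes transversal to
the plane `(I, sI)`, centred at the vertical plane. -/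
noncomputable def chartMatrix (s : ℝ) (Y : Matrix (Fin n ⊕ Fin n) (Fin n) ℝ) :
    Matrix (Fin n) (Fin n) ℝ :=
  Y.toRows₁ * (chartDenom s Y)⁻¹

theorem toRows₁_eq_chartMatrix_mul {s : ℝ} {Y : Matrix (Fin n ⊕ Fin n) (Fin n) ℝ}
    (hs : IsUnit (chartDenom s Y).det) : Y.toRows₁ = chartMatrix s Y * chartDenom s Y := by
  rw [chartMatrix, Matrix.mul_assoc, nonsing_inv_mul _ hs, Matrix.mul_one]

theorem IsLagrangian.transpose_chartMatrix {s : ℝ} {Y : Matrix (Fin n ⊕ Fin n) (Fin n) ℝ}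
    (hY : IsLagrangian Y) (hs : IsUnit (chartDenom s Y).det) :
    (chartMatrix s Y)ᵀ = chartMatrix s Y := by
  have h1 : (chartDenom s Y)ᵀ * Y.toRows₁ = Y.toRows₁ᵀ * chartDenom s Y := by
    simp only [chartDenom, transpose_sub, transpose_smul, Matrix.sub_mul, Matrix.mul_sub,
      hY.transpose_mul_eq, Matrix.smul_mul, Matrix.mul_smul]
  have hsT : IsUnit (chartDenom s Y)ᵀ.det := by rwa [det_transpose]
  rw [chartMatrix, transpose_mul, transpose_nonsing_inv]
  calc (chartDenom s Y)ᵀ⁻¹ * Y.toRows₁ᵀ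
      = (chartDenom s Y)ᵀ⁻¹ * (Y.toRows₁ᵀ * chartDenom s Y) * (chartDenom s Y)⁻¹ := by
        rw [Matrix.mul_assoc, Matrix.mul_assoc, mul_nonsing_inv _ hs, Matrix.mul_one]
    _ = Y.toRows₁ * (chartDenom s Y)⁻¹ := by
        rw [← h1, ← Matrix.mul_assoc, nonsing_inv_mul _ hsT, Matrix.one_mul]

/-- The two terms in `s` cancel. Hence the rank of `A - B` is that of the Wronskian, independently
of `s`. -/
theorem wronskian_eq_chart {s : ℝ} {Y Z : Matrix (Fin n ⊕ Fin n) (Fin n) ℝ}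
    (hY : IsLagrangian Y) (hYs : IsUnit (chartDenom s Y).det)
    (hZs : IsUnit (chartDenom s Z).det) :
    wronskian Y Z = (chartDenom s Y)ᵀ * (chartMatrix s Y - chartMatrix s Z) * chartDenom s Z := by
  have h1 : (chartDenom s Y)ᵀ * chartMatrix s Y = Y.toRows₁ᵀ := by
    rw [toRows₁_eq_chartMatrix_mul hYs, transpose_mul, hY.transpose_chartMatrix hYs]
  rw [Matrix.mul_sub, Matrix.sub_mul, h1, Matrix.mul_assoc, ← toRows₁_eq_chartMatrix_mul hZs,
    wronskian_eq]
  simp only [chartDenom, transpose_sub, transpose_smul, Matrix.sub_mul, Matrix.mul_sub,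
    Matrix.smul_mul, Matrix.mul_smul]
  abel

theorem rank_chartMatrix {s : ℝ} {Y : Matrix (Fin n ⊕ Fin n) (Fin n) ℝ}
    (hs : IsUnit (chartDenom s Y).det) : (chartMatrix s Y).rank = Y.toRows₁.rank := by
  rw [toRows₁_eq_chartMatrix_mul hs, rank_mul_eq_left_of_isUnit_det _ _ hs]

theorem rank_chartMatrix_sub {s : ℝ} {Y Z : Matrix (Fin n ⊕ Fin n) (Fin n) ℝ}
    (hY : IsLagrangian Y) (hYs : IsUnit (chartDenom s Y).det)
    (hZs : IsUnit (chartDenom s Z).det) :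
    (chartMatrix s Y - chartMatrix s Z).rank = (wronskian Y Z).rank := by
  rw [wronskian_eq_chart hY hYs hZs, rank_mul_eq_left_of_isUnit_det _ _ hZs,
    rank_mul_eq_right_of_isUnit_det _ _ (by rwa [det_transpose])]

/-- Every Lagrangian plane is transversal to the plane `(I, sI)` for all but finitely many `s`. -/
theorem IsLagrangian.eventually_isUnit_chartDenom {Y : Matrix (Fin n ⊕ Fin n) (Fin n) ℝ}
    (hY : IsLagrangian Y) : ∀ᶠ s in cofinite, IsUnit (chartDenom s Y).det := by
  set p : ℝ[X] := (Y.toRows₂.map C - (X : ℝ[X]) • Y.toRows₁.map C).det with hp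
  have hev : ∀ s, p.eval s = (chartDenom s Y).det := by
    intro s
    rw [hp, ← coe_evalRingHom, RingHom.map_det]
    congr 1
    ext i j
    simp [chartDenom]
    exact mul_comm _ _
  have hp0 : p ≠ 0 := by
    intro h0
    -- The determinant is a polynomial in `s` that does not vanish at `s = i`: by the Lagrangian
    -- condition, `(U + iX)ᵀ (U - iX) = Yᵀ Y`, which is invertible.
    have hI : (Y.toRows₂.map (algebraMap ℝ ℂ) - Complex.I • Y.toRows₁.map (algebraMap ℝ ℂ)).det
        = 0 := by
      rw [← map_zero (aeval (R := ℝ) Complex.I), ← h0, hp, AlgHom.map_det]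
      congr 1
      ext i j
      simp
      exact mul_comm _ _
    have hprod : (Y.toRows₂.map (algebraMap ℝ ℂ) + Complex.I • Y.toRows₁.map (algebraMap ℝ ℂ))ᵀ *
        (Y.toRows₂.map (algebraMap ℝ ℂ) - Complex.I • Y.toRows₁.map (algebraMap ℝ ℂ)) =
        (Yᵀ * Y).map (algebraMap ℝ ℂ) := by
      have h1 : Yᵀ * Y = Y.toRows₁ᵀ * Y.toRows₁ + Y.toRows₂ᵀ * Y.toRows₂ := by
        conv_lhs => rw [← fromRows_toRows Y, transpose_fromRows, fromCols_mul_fromRows]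
      have h2 := congrArg (fun M => M.map (algebraMap ℝ ℂ)) hY.transpose_mul_eq
      simp only [Matrix.map_mul] at h2
      rw [h1, Matrix.map_add _ (by simp), Matrix.map_mul, Matrix.map_mul, transpose_add,
        transpose_smul, Matrix.add_mul, Matrix.mul_sub, Matrix.mul_sub]
      simp only [Matrix.smul_mul, Matrix.mul_smul, smul_smul, Complex.I_mul_I, transpose_map]
        at h2 ⊢
      rw [h2]
      simp only [neg_smul, one_smul]
      abel
    have hdet := congrArg Matrix.det hprod
    rw [det_mul, hI, mul_zero, ← RingHom.mapMatrix_apply, ← RingHom.map_det] at hdet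
    exact hY.isUnit_det.ne_zero (by simpa using hdet.symm)
  refine (p.roots.toFinset.finite_toSet.subset ?_ : Set.Finite _)
  intro s hs
  have : (chartDenom s Y).det = 0 := by simpa using hs
  simp [hp0, hev, this]

theorem signedIndex_chart {ε : ℝ} (hε : ε * ε = 1) {s : ℝ}
    {Y Z : Matrix (Fin n ⊕ Fin n) (Fin n) ℝ} (hY : IsLagrangian Y) (hZ : IsLagrangian Z)
    (hYs : IsUnit (chartDenom s Y).det) (hZs : IsUnit (chartDenom s Z).det) :
    signedIndex ε Y Z + negInd (ε • chartMatrix s Y) =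
      negInd (ε • (chartMatrix s Y - chartMatrix s Z)) + negInd (ε • chartMatrix s Z) :=
  signedIndex_add_negInd hε hYs hZs (hY.transpose_chartMatrix hYs) (hZ.transpose_chartMatrix hZs)
    (toRows₁_eq_chartMatrix_mul hYs) (toRows₁_eq_chartMatrix_mul hZs)
    (wronskian_eq_chart hY hYs hZs)

theorem continuous_chartDenom (s : ℝ) :
    Continuous (chartDenom s : Matrix (Fin n ⊕ Fin n) (Fin n) ℝ → _) := by
  unfold chartDenom
  refine Continuous.sub ?_ (Continuous.const_smul ?_ s)
  · exact continuous_matrix fun i j => continuous_id.matrix_elem _ _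
  · exact continuous_matrix fun i j => continuous_id.matrix_elem _ _

theorem eventually_isUnit_chartDenom_nhds {s : ℝ} {Y : Matrix (Fin n ⊕ Fin n) (Fin n) ℝ}
    (hs : IsUnit (chartDenom s Y).det) : ∀ᶠ Z in 𝓝 Y, IsUnit (chartDenom s Z).det := by
  simp only [isUnit_iff_ne_zero] at hs ⊢
  exact (continuous_chartDenom s).matrix_det.continuousAt.eventually_ne hs

theorem continuousAt_chartMatrix {s : ℝ} {Y : Matrix (Fin n ⊕ Fin n) (Fin n) ℝ}
    (hs : IsUnit (chartDenom s Y).det) : ContinuousAt (chartMatrix s) Y := by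
  have h1 : ContinuousAt (fun Z => (chartDenom s Z)⁻¹) Y := by
    refine ContinuousAt.comp (g := Inv.inv) (continuousAt_matrix_inv _ ?_)
      (continuous_chartDenom s).continuousAt
    rw [Ring.inverse_eq_inv']
    exact continuousAt_inv₀ hs.ne_zero
  have h2 : ContinuousAt
      (fun Z : Matrix (Fin n ⊕ Fin n) (Fin n) ℝ => Z.toRows₁) Y :=
    (continuous_matrix fun i j => continuous_id.matrix_elem _ _).continuousAt
  have h3 : Continuous fun q : Matrix (Fin n) (Fin n) ℝ × Matrix (Fin n) (Fin n) ℝ =>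
      q.1 * q.2 := by fun_prop
  exact ContinuousAt.comp (f := fun Z : Matrix (Fin n ⊕ Fin n) (Fin n) ℝ =>
    (Z.toRows₁, (chartDenom s Z)⁻¹)) h3.continuousAt (h2.prodMk h1)

variable {α : Type*} {l : Filter α} {Y Z : α → Matrix (Fin n ⊕ Fin n) (Fin n) ℝ}
  {Y₀ Z₀ : Matrix (Fin n ⊕ Fin n) (Fin n) ℝ}

/-- If the rank of the upper block is constant, the index of the chart matrix is constant. -/
theorem eventually_negInd_chartMatrix_eq {ε : ℝ} (hε : ε * ε = 1) {s : ℝ}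
    (hl : Tendsto Y l (𝓝 Y₀)) (hY : ∀ᶠ t in l, IsLagrangian (Y t)) (hY₀ : IsLagrangian Y₀)
    (hs : IsUnit (chartDenom s Y₀).det)
    (hr : ∀ᶠ t in l, (Y t).toRows₁.rank = Y₀.toRows₁.rank) :
    ∀ᶠ t in l, negInd (ε • chartMatrix s (Y t)) = negInd (ε • chartMatrix s Y₀) := by
  have hu := hl.eventually (eventually_isUnit_chartDenom_nhds hs)
  refine eventually_negInd_eq ?_ ?_ (((continuousAt_chartMatrix hs).tendsto.comp hl).const_smul ε)
    ?_
  · filter_upwards [hu, hY] with t h1 h2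
    rw [transpose_smul, h2.transpose_chartMatrix h1]
  · rw [transpose_smul, hY₀.transpose_chartMatrix hs]
  · filter_upwards [hu, hr] with t h1 h2
    rw [rank_smul_of_mul_self hε, rank_smul_of_mul_self hε,
      rank_chartMatrix h1, rank_chartMatrix hs, h2]

/-- If the rank of the Wronskian is constant, the increment of the comparative index is the
increment of the difference of the indices of the chart matrices. -/
theorem eventually_signedIndex_sub_eq {ε : ℝ} (hε : ε * ε = 1) {s : ℝ}
    (hlY : Tendsto Y l (𝓝 Y₀)) (hlZ : Tendsto Z l (𝓝 Z₀))
    (hY : ∀ᶠ t in l, IsLagrangian (Y t)) (hZ : ∀ᶠ t in l, IsLagrangian (Z t))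
    (hY₀ : IsLagrangian Y₀) (hZ₀ : IsLagrangian Z₀)
    (hYs : IsUnit (chartDenom s Y₀).det) (hZs : IsUnit (chartDenom s Z₀).det)
    (hr : ∀ᶠ t in l, (wronskian (Y t) (Z t)).rank = (wronskian Y₀ Z₀).rank) :
    ∀ᶠ t in l, (signedIndex ε (Y t) (Z t) : ℤ) - signedIndex ε Y₀ Z₀ =
      ((negInd (ε • chartMatrix s (Z t)) : ℤ) - negInd (ε • chartMatrix s Z₀)) -
        ((negInd (ε • chartMatrix s (Y t)) : ℤ) - negInd (ε • chartMatrix s Y₀)) := by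
  have huY := hlY.eventually (eventually_isUnit_chartDenom_nhds hYs)
  have huZ := hlZ.eventually (eventually_isUnit_chartDenom_nhds hZs)
  have hconst : ∀ᶠ t in l, negInd (ε • (chartMatrix s (Y t) - chartMatrix s (Z t))) =
      negInd (ε • (chartMatrix s Y₀ - chartMatrix s Z₀)) := by
    refine eventually_negInd_eq ?_ ?_
      ((((continuousAt_chartMatrix hYs).tendsto.comp hlY).sub
        ((continuousAt_chartMatrix hZs).tendsto.comp hlZ)).const_smul ε) ?_
    · filter_upwards [huY, huZ, hY, hZ] with t h1 h2 h3 h4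
      rw [transpose_smul, transpose_sub, h3.transpose_chartMatrix h1, h4.transpose_chartMatrix h2]
    · rw [transpose_smul, transpose_sub, hY₀.transpose_chartMatrix hYs,
        hZ₀.transpose_chartMatrix hZs]
    · filter_upwards [huY, huZ, hY, hr] with t h1 h2 h3 h4
      rw [rank_smul_of_mul_self hε,
        rank_smul_of_mul_self hε, rank_chartMatrix_sub h3 h1 h2, rank_chartMatrix_sub hY₀ hYs hZs,
        h4]
  have h0 := signedIndex_chart hε hY₀ hZ₀ hYs hZs
  filter_upwards [huY, huZ, hY, hZ, hconst] with t h1 h2 h3 h4 h5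
  have h6 := signedIndex_chart hε h3 h4 h1 h2
  omega

end Chart
end LagrangianPath

namespace LagrangianPath

open Matrix Polynomial Filter Topology Set

/-! ### Primitives of the index and oscillation sums. -/

section Oscillation

variable {n : ℕ}

/-- The increments of `F` on `[u, v]` are locally those of minus the index of the chart matrix
of `Y`. -/
def IsIndexPrimitive (ε : ℝ) (Y : ℝ → Matrix (Fin n ⊕ Fin n) (Fin n) ℝ) (F : ℝ → ℤ)
    (u v : ℝ) : Prop :=
  ∀ t₀ ∈ Icc u v, ∀ᶠ s in cofinite, ∀ᶠ t in 𝓝[Icc u v] t₀,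
    F t - F t₀ = (negInd (ε • chartMatrix s (Y t₀)) : ℤ) - negInd (ε • chartMatrix s (Y t))

/-- Only increments matter, so `G` may be shifted to agree with `F` at `v`; this absorbs the jump
caused by a change of frame. -/
theorem IsIndexPrimitive.concat {ε : ℝ} {Y : ℝ → Matrix (Fin n ⊕ Fin n) (Fin n) ℝ}
    {F G : ℝ → ℤ} {u v w : ℝ} (huv : u ≤ v) (hvw : v ≤ w) (hF : IsIndexPrimitive ε Y F u v)
    (hG : IsIndexPrimitive ε Y G v w) :
    IsIndexPrimitive ε Y (fun t => if t ≤ v then F t else F v + (G t - G v)) u w := by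
  set H : ℝ → ℤ := fun t => if t ≤ v then F t else F v + (G t - G v) with hH
  have h1 : ∀ t ∈ Icc u v, H t = F t := fun t ht => if_pos ht.2
  have h2 : ∀ t ∈ Icc v w, H t = F v + (G t - G v) := by
    intro t ht
    rcases ht.1.eq_or_lt with rfl | hlt
    · simp [hH]
    · exact if_neg hlt.not_ge
  intro t₀ _
  rw [← Icc_union_Icc_eq_Icc huv hvw]
  simp only [nhdsWithin_union, eventually_sup]
  refine Filter.Eventually.and ?_ ?_
  · by_cases h0 : t₀ ∈ Icc u v
    · filter_upwards [hF t₀ h0] with s hs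
      filter_upwards [hs, self_mem_nhdsWithin] with t ht htm
      rw [h1 t htm, h1 t₀ h0, ht]
    -- Away from this closed piece its neighbourhood filter at `t₀` is trivial.
    · rw [← isClosed_Icc.closure_eq, notMem_closure_iff_nhdsWithin_eq_bot] at h0
      simp [h0]
  · by_cases h0 : t₀ ∈ Icc v w
    · filter_upwards [hG t₀ h0] with s hs
      filter_upwards [hs, self_mem_nhdsWithin] with t ht htm
      rw [h2 t htm, h2 t₀ h0, ← ht]
      ring
    · rw [← isClosed_Icc.closure_eq, notMem_closure_iff_nhdsWithin_eq_bot] at h0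
      simp [h0]

theorem canonJ_eq (n : ℕ) : canonJ n = -Matrix.J (Fin n) ℝ := by
  simp [canonJ, Matrix.J, fromBlocks_neg]

theorem transpose_mul_canonJ_mul {S : Matrix (Fin n ⊕ Fin n) (Fin n ⊕ Fin n) ℝ}
    (hS : S ∈ Matrix.symplecticGroup (Fin n) ℝ) : Sᵀ * canonJ n * S = canonJ n := by
  rw [canonJ_eq, Matrix.mul_neg, Matrix.neg_mul, SymplecticGroup.mem_iff'.mp hS]

theorem wronskian_mul_mul {S : Matrix (Fin n ⊕ Fin n) (Fin n ⊕ Fin n) ℝ}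
    (hS : S ∈ Matrix.symplecticGroup (Fin n) ℝ) (Y Z : Matrix (Fin n ⊕ Fin n) (Fin n) ℝ) :
    wronskian (S * Y) (S * Z) = wronskian Y Z := by
  calc wronskian (S * Y) (S * Z) = Yᵀ * (Sᵀ * canonJ n * S) * Z := by
        simp only [wronskian, transpose_mul, Matrix.mul_assoc]
    _ = _ := by rw [transpose_mul_canonJ_mul hS]; rfl

theorem IsLagrangian.symplectic_mul {S : Matrix (Fin n ⊕ Fin n) (Fin n ⊕ Fin n) ℝ}
    (hS : S ∈ Matrix.symplecticGroup (Fin n) ℝ) {Y : Matrix (Fin n ⊕ Fin n) (Fin n) ℝ}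
    (hY : IsLagrangian Y) : IsLagrangian (S * Y) := by
  refine ⟨(wronskian_mul_mul hS Y Y).trans hY.1, ?_⟩
  rw [rank_mul_eq_right_of_isUnit_det _ _ (SymplecticGroup.symplectic_det hS), hY.2]

theorem isLagrangian_vertE (n : ℕ) : IsLagrangian (vertE n) := by
  refine ⟨?_, ?_⟩
  · exact (wronskian_eq (vertE n) (vertE n)).trans (by simp [vertE])
  · rw [← rank_transpose_mul_self, vertE, transpose_fromRows, fromCols_mul_fromRows]
    simp

theorem tendsto_mul_vertE {α : Type*} {l : Filter α}
    {R : α → Matrix (Fin n ⊕ Fin n) (Fin n ⊕ Fin n) ℝ}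
    {R₀ : Matrix (Fin n ⊕ Fin n) (Fin n ⊕ Fin n) ℝ} (hR : Tendsto R l (𝓝 R₀)) :
    Tendsto (fun t => R t * vertE n) l (𝓝 (R₀ * vertE n)) := by
  have h : Continuous fun S : Matrix (Fin n ⊕ Fin n) (Fin n ⊕ Fin n) ℝ => S * vertE n := by
    fun_prop
  exact (h.tendsto R₀).comp hR

/-- The index of a Lagrangian path relative to an admissible moving frame is a primitive. -/
theorem isIndexPrimitive_signedIndex {ε : ℝ} (hε : ε * ε = 1) {u v : ℝ}
    {Y : ℝ → Matrix (Fin n ⊕ Fin n) (Fin n) ℝ}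
    {R : ℝ → Matrix (Fin n ⊕ Fin n) (Fin n ⊕ Fin n) ℝ} (hYc : ContinuousOn Y (Icc u v))
    (hY : ∀ t ∈ Icc u v, IsLagrangian (Y t)) (hRc : ContinuousOn R (Icc u v))
    (hR : ∀ t ∈ Icc u v, R t ∈ Matrix.symplecticGroup (Fin n) ℝ)
    (hW : ∃ r : ℕ, ∀ t ∈ Icc u v, (wronskian (R t * vertE n) (Y t)).rank = r)
    (hX : ∃ r : ℕ, ∀ t ∈ Icc u v, (R t * vertE n).toRows₁.rank = r) :
    IsIndexPrimitive ε Y (fun t => signedIndex ε (Y t) (R t * vertE n)) u v := by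
  obtain ⟨r, hr⟩ := hW
  obtain ⟨q, hq⟩ := hX
  have hRE : ∀ t ∈ Icc u v, IsLagrangian (R t * vertE n) := fun t ht =>
    (isLagrangian_vertE n).symplectic_mul (hR t ht)
  intro t₀ ht₀
  filter_upwards [(hY t₀ ht₀).eventually_isUnit_chartDenom,
    (hRE t₀ ht₀).eventually_isUnit_chartDenom] with s hs1 hs2
  have hlY : Tendsto Y (𝓝[Icc u v] t₀) (𝓝 (Y t₀)) := hYc t₀ ht₀
  have hlR := tendsto_mul_vertE (hRc t₀ ht₀).tendsto
  have hmem : ∀ᶠ t in 𝓝[Icc u v] t₀, t ∈ Icc u v := self_mem_nhdsWithin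
  have h1 := eventually_signedIndex_sub_eq hε hlY hlR (hmem.mono hY) (hmem.mono hRE) (hY t₀ ht₀)
    (hRE t₀ ht₀) hs1 hs2 (hmem.mono fun t ht => by
      rw [rank_wronskian_swap, hr t ht, rank_wronskian_swap, hr t₀ ht₀])
  have h2 := eventually_negInd_chartMatrix_eq hε hlR (hmem.mono hRE) (hRE t₀ ht₀) hs2
    (hmem.mono fun t ht => by rw [hq t ht, hq t₀ ht₀])
  filter_upwards [h1, h2] with t h3 h4
  rw [h3, h4]
  ring

/-- The oscillation sum (`ε = 1`), or minus the dual oscillation sum (`ε = -1`). -/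
noncomputable def OscSystem.signedSum (D : OscSystem n) (ε : ℝ)
    (Y : ℝ → Matrix (Fin n ⊕ Fin n) (Fin n) ℝ) (m : ℕ) : ℤ :=
  ∑ k ∈ Finset.range m,
    ((signedIndex ε (Y (D.t (k + 1))) (D.R k (D.t (k + 1)) * vertE n) : ℤ)
      - (signedIndex ε (Y (D.t k)) (D.R k (D.t k) * vertE n) : ℤ))

theorem OscSystem.signedSum_one (D : OscSystem n) (Y : ℝ → Matrix (Fin n ⊕ Fin n) (Fin n) ℝ) :
    D.signedSum 1 Y D.p = D.oscSum Y := by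
  simp only [signedSum, oscSum, signedIndex_one]

theorem OscSystem.signedSum_neg_one (D : OscSystem n)
    (Y : ℝ → Matrix (Fin n ⊕ Fin n) (Fin n) ℝ) :
    D.signedSum (-1) Y D.p = -D.dualOscSum Y := by
  simp only [signedSum, dualOscSum, signedIndex_neg_one, ← Finset.sum_neg_distrib, neg_sub]

theorem OscSystem.Admissible.le_of_le {D : OscSystem n} {a b : ℝ}
    {Y : ℝ → Matrix (Fin n ⊕ Fin n) (Fin n) ℝ} (hD : D.Admissible a b Y) {i j : ℕ} (hij : i ≤ j)
    (hj : j ≤ D.p) : D.t i ≤ D.t j := by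
  induction j, hij using Nat.le_induction with
  | base => exact le_rfl
  | succ j hij ih => exact (ih (by omega)).trans (hD.lt_succ j (by omega)).le

theorem OscSystem.Admissible.exists_primitive {ε : ℝ} (hε : ε * ε = 1) {D : OscSystem n}
    {a b : ℝ} {Y : ℝ → Matrix (Fin n ⊕ Fin n) (Fin n) ℝ} (hD : D.Admissible a b Y)
    (hYc : ContinuousOn Y (Icc a b)) (hY : ∀ t ∈ Icc a b, IsLagrangian (Y t)) :
    ∃ F : ℝ → ℤ, F a = 0 ∧ F b = D.signedSum ε Y D.p ∧ IsIndexPrimitive ε Y F a b := by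
  suffices h : ∀ m ≤ D.p, ∃ F : ℝ → ℤ, F a = 0 ∧ F (D.t m) = D.signedSum ε Y m ∧
      IsIndexPrimitive ε Y F a (D.t m) by
    have := h D.p le_rfl
    rwa [hD.right] at this
  intro m
  induction m with
  | zero =>
    intro _
    refine ⟨fun _ => 0, rfl, by simp [OscSystem.signedSum], ?_⟩
    intro t₀ ht₀
    -- The interval is the single point `a`, where every increment is zero.
    rw [hD.left, Icc_self, mem_singleton_iff] at ht₀
    rw [hD.left, ht₀, Icc_self, nhdsWithin_singleton]
    simp
  | succ m ih =>
    intro hm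
    obtain ⟨F, hFa, hFm, hF⟩ := ih (by omega)
    have ha : a ≤ D.t m := hD.left ▸ hD.le_of_le (Nat.zero_le m) (by omega)
    have hb : D.t (m + 1) ≤ b := hD.right ▸ hD.le_of_le hm le_rfl
    have hlt := hD.lt_succ m (by omega)
    have hsub : Icc (D.t m) (D.t (m + 1)) ⊆ Icc a b := Icc_subset_Icc ha hb
    have hG := isIndexPrimitive_signedIndex hε (hYc.mono hsub) (fun t ht => hY t (hsub ht))
      (hD.continuousOn m (by omega)) (hD.symplectic m (by omega)) (hD.rank_wronskian m (by omega))
      (hD.rank_upper m (by omega))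
    refine ⟨_, ?_, ?_, hF.concat ha hlt.le hG⟩
    · simp [ha, hFa]
    · simp only [not_le.mpr hlt, if_false, hFm, OscSystem.signedSum, Finset.sum_range_succ]

/-- The difference of the oscillation sums of two Lagrangian paths whose Wronskian has constant
rank is the increment of their comparative index. -/
theorem signedSum_sub_signedSum {ε : ℝ} (hε : ε * ε = 1) {a b : ℝ} (hab : a ≤ b)
    {Y Z : ℝ → Matrix (Fin n ⊕ Fin n) (Fin n) ℝ}
    (hYc : ContinuousOn Y (Icc a b)) (hY : ∀ t ∈ Icc a b, IsLagrangian (Y t))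
    (hZc : ContinuousOn Z (Icc a b)) (hZ : ∀ t ∈ Icc a b, IsLagrangian (Z t))
    (hW : ∃ r : ℕ, ∀ t ∈ Icc a b, (wronskian (Y t) (Z t)).rank = r)
    {D D' : OscSystem n} (hD : D.Admissible a b Y) (hD' : D'.Admissible a b Z) :
    D.signedSum ε Y D.p - D'.signedSum ε Z D'.p =
      (signedIndex ε (Y b) (Z b) : ℤ) - signedIndex ε (Y a) (Z a) := by
  obtain ⟨F, hFa, hFb, hF⟩ := hD.exists_primitive hε hYc hY
  obtain ⟨G, hGa, hGb, hG⟩ := hD'.exists_primitive hε hZc hZ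
  obtain ⟨r, hr⟩ := hW
  set H : ℝ → ℤ := fun t => F t - G t - signedIndex ε (Y t) (Z t) with hH
  have hcont : ContinuousOn H (Icc a b) := by
    intro t₀ ht₀
    -- Each condition excludes only finitely many `s`, so a single chart serves both planes and both
    -- primitives.
    obtain ⟨s, hs1, hs2, hs3, hs4⟩ := (((hY t₀ ht₀).eventually_isUnit_chartDenom.and
      ((hZ t₀ ht₀).eventually_isUnit_chartDenom.and ((hF t₀ ht₀).and (hG t₀ ht₀))))).exists
    have hmem : ∀ᶠ t in 𝓝[Icc a b] t₀, t ∈ Icc a b := self_mem_nhdsWithin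
    have h1 := eventually_signedIndex_sub_eq hε (hYc t₀ ht₀).tendsto (hZc t₀ ht₀).tendsto
      (hmem.mono hY) (hmem.mono hZ) (hY t₀ ht₀) (hZ t₀ ht₀) hs1 hs2
      (hmem.mono fun t ht => by rw [hr t ht, hr t₀ ht₀])
    refine (tendsto_const_nhds (x := H t₀)).congr' ?_
    filter_upwards [h1, hs3, hs4] with t h2 h3 h4
    simp only [hH]
    linarith
  -- A continuous function from an interval to the discrete space `ℤ` is constant.
  have hconst := isPreconnected_Icc.constant hcont (left_mem_Icc.mpr hab) (right_mem_Icc.mpr hab)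
  simp only [hH] at hconst
  rw [← hFb, ← hGb]
  linarith

theorem wronskian_self {Y : Matrix (Fin n ⊕ Fin n) (Fin n) ℝ} (hY : IsLagrangian Y) :
    wronskian Y Y = 0 := hY.1

/-- In the chart formula `A - B = 0` and the other two indices cancel. -/
theorem signedIndex_self {ε : ℝ} (hε : ε * ε = 1) {Y : Matrix (Fin n ⊕ Fin n) (Fin n) ℝ}
    (hY : IsLagrangian Y) : signedIndex ε Y Y = 0 := by
  obtain ⟨s, hs⟩ := hY.eventually_isUnit_chartDenom.exists
  have h := signedIndex_chart hε hY hY hs hs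
  have h0 : negInd (0 : Matrix (Fin n) (Fin n) ℝ) = 0 := by
    have := negInd_add_negInd_neg (A := (0 : Matrix (Fin n) (Fin n) ℝ)) (by simp)
    rw [rank_zero] at this
    omega
  rw [sub_self, smul_zero, h0] at h
  omega

/-- Two admissible systems for the same path have equal oscillation sums. -/
theorem signedSum_eq {ε : ℝ} (hε : ε * ε = 1) {a b : ℝ} (hab : a ≤ b)
    {Y : ℝ → Matrix (Fin n ⊕ Fin n) (Fin n) ℝ}
    (hYc : ContinuousOn Y (Icc a b)) (hY : ∀ t ∈ Icc a b, IsLagrangian (Y t))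
    {D D' : OscSystem n} (hD : D.Admissible a b Y) (hD' : D'.Admissible a b Y) :
    D.signedSum ε Y D.p = D'.signedSum ε Y D'.p := by
  have h := signedSum_sub_signedSum hε hab hYc hY hYc hY
    ⟨0, fun t ht => by rw [wronskian_self (hY t ht), rank_zero]⟩ hD hD'
  rw [signedIndex_self hε (hY a (left_mem_Icc.mpr hab)),
    signedIndex_self hε (hY b (right_mem_Icc.mpr hab))] at h
  linarith

/-- A symplectic matrix that maps the vertical plane to the plane `(I, sI)`. -/
def shearRotation (n : ℕ) (s : ℝ) : Matrix (Fin n ⊕ Fin n) (Fin n ⊕ Fin n) ℝ :=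
  fromBlocks 0 1 (-1) (s • 1)

theorem shearRotation_mem (n : ℕ) (s : ℝ) :
    shearRotation n s ∈ Matrix.symplecticGroup (Fin n) ℝ := by
  rw [SymplecticGroup.mem_iff, shearRotation, Matrix.J, fromBlocks_transpose,
    fromBlocks_multiply, fromBlocks_multiply]
  simp

theorem wronskian_shearRotation (s : ℝ) (Y : Matrix (Fin n ⊕ Fin n) (Fin n) ℝ) :
    wronskian (shearRotation n s * vertE n) Y = chartDenom s Y := by
  rw [wronskian_eq, shearRotation, vertE, fromBlocks_mul_fromRows]
  simp [chartDenom]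

/-- Continuous Lagrangian paths have admissible systems. -/
theorem exists_admissible {a b : ℝ} (hab : a < b) {Y : ℝ → Matrix (Fin n ⊕ Fin n) (Fin n) ℝ}
    (hYc : ContinuousOn Y (Icc a b)) (hY : ∀ t ∈ Icc a b, IsLagrangian (Y t)) :
    ∃ D : OscSystem n, D.Admissible a b Y := by
  -- The extension is continuous on all of `ℝ`, so the transversality sets below are open in `ℝ`, as
  -- the Lebesgue number lemma requires.
  set f : ℝ → Matrix (Fin n ⊕ Fin n) (Fin n) ℝ := IccExtend hab.le ((Icc a b).domRestrict Y)
  have hf : Continuous f := hYc.domRestrict.Icc_extend'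
  have hfY : ∀ t ∈ Icc a b, f t = Y t := fun t ht => by
    exact IccExtend_of_mem hab.le ((Icc a b).domRestrict Y) ht
  obtain ⟨δ, hδ, hcov⟩ := lebesgue_number_lemma_of_metric (s := Icc a b)
    (c := fun s : ℝ => {t | IsUnit (chartDenom s (f t)).det}) isCompact_Icc
    (fun s => by
      simp only [isUnit_iff_ne_zero]
      exact isOpen_ne_fun ((continuous_chartDenom s).comp hf).matrix_det continuous_const)
    (fun t ht => by
      obtain ⟨s, hs⟩ := (hY t ht).eventually_isUnit_chartDenom.exists
      exact mem_iUnion.mpr ⟨s, by simpa only [mem_ofPred_eq, hfY t ht] using hs⟩)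
  obtain ⟨N, hN⟩ := exists_nat_gt ((b - a) / δ)
  have hN0 : (0 : ℝ) < N := (div_pos (sub_pos.mpr hab) hδ).trans hN
  set h : ℝ := (b - a) / N with hh
  have hh0 : 0 < h := div_pos (sub_pos.mpr hab) hN0
  have hhδ : h < δ := by rw [hh, div_lt_comm₀ hN0 hδ]; exact hN
  have hNh : N * h = b - a := mul_div_cancel₀ _ hN0.ne'
  have hmem : ∀ k < N, ∀ t ∈ Icc (a + k * h) (a + (k + 1 : ℕ) * h), t ∈ Icc a b := by
    intro k hk t ht
    have h1 : ((k + 1 : ℕ) : ℝ) * h ≤ N * h :=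
      mul_le_mul_of_nonneg_right (by exact_mod_cast hk) hh0.le
    have h2 : 0 ≤ (k : ℝ) * h := by positivity
    exact ⟨by linarith [ht.1], by linarith [ht.2]⟩
  have hstep : ∀ k : ℕ, a + k * h < a + (k + 1 : ℕ) * h := fun k => by push_cast; linarith
  have hex : ∀ k : ℕ, ∃ s : ℝ, k < N → ∀ t ∈ Icc (a + k * h) (a + (k + 1 : ℕ) * h),
      IsUnit (chartDenom s (Y t)).det := by
    intro k
    by_cases hk : k < N
    · obtain ⟨s, hs⟩ := hcov (a + k * h) (hmem k hk _ (left_mem_Icc.mpr (hstep k).le))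
      refine ⟨s, fun _ t ht => ?_⟩
      rw [← hfY t (hmem k hk t ht)]
      refine hs ?_
      rw [Metric.mem_ball, Real.dist_eq, abs_of_nonneg (by linarith [ht.1])]
      have := ht.2
      push_cast at this
      linarith
    · exact ⟨0, fun h => absurd h hk⟩
  choose s hs using hex
  -- On each subinterval the frame is constant and `R E` is the plane `(I, sI)`, to which `Y` stays
  -- transversal: the Wronskian has full rank and the upper block is fixed.
  refine ⟨⟨N, fun k => a + k * h, fun k _ => shearRotation n (s k)⟩, ?_, ?_, ?_, ?_, ?_, ?_, ?_⟩
  · simp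
  · simp only [hNh]; ring
  · exact fun k _ => hstep k
  · exact fun k _ t _ => shearRotation_mem n (s k)
  · exact fun k _ => continuousOn_const
  · refine fun k hk => ⟨n, fun t ht => ?_⟩
    rw [wronskian_shearRotation, rank_of_isUnit _ ((isUnit_iff_isUnit_det _).mpr (hs k hk t ht)),
      Fintype.card_fin]
  · exact fun k _ => ⟨(shearRotation n (s k) * vertE n).toRows₁.rank, fun t _ => rfl⟩

theorem oscWellDefined {a b : ℝ} (hab : a < b) {Y : ℝ → Matrix (Fin n ⊕ Fin n) (Fin n) ℝ}
    (hYc : ContinuousOn Y (Icc a b)) (hY : ∀ t ∈ Icc a b, IsLagrangian (Y t)) :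
    OscWellDefined a b Y := by
  have hex := exists_admissible hab hYc hY
  refine ⟨hex, fun D hD => ?_⟩
  rw [oscNumber, dualOscNumber, dif_pos hex, dif_pos hex, ← OscSystem.signedSum_one,
    ← OscSystem.signedSum_one]
  have h := signedSum_eq (ε := -1) (by norm_num) hab.le hYc hY hD hex.choose_spec
  rw [OscSystem.signedSum_neg_one, OscSystem.signedSum_neg_one, neg_inj] at h
  exact ⟨signedSum_eq (by norm_num) hab.le hYc hY hD hex.choose_spec, h⟩

end Oscillation

end LagrangianPath

/-! ### The theorem for two paths moved by the same symplectic flow. -/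

open LagrangianPath in
theorem theoremT (n : ℕ) (a b : ℝ) (hab : a < b)
    (Φ : ℝ → Matrix (Fin n ⊕ Fin n) (Fin n ⊕ Fin n) ℝ)
    (hΦ : ContinuousOn Φ (Set.Icc a b))
    (hΦs : ∀ t ∈ Set.Icc a b, Φ t ∈ Matrix.symplecticGroup (Fin n) ℝ)
    (Y Yhat : ℝ → Matrix (Fin n ⊕ Fin n) (Fin n) ℝ)
    (hY : Y ∈ LagrangianPath.pathFamily a b Φ)
    (hYhat : Yhat ∈ LagrangianPath.pathFamily a b Φ) :
    LagrangianPath.OscWellDefined a b Y ∧ LagrangianPath.OscWellDefined a b Yhat ∧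
    LagrangianPath.oscNumber a b Y - LagrangianPath.oscNumber a b Yhat =
      (LagrangianPath.compIndex (Y b) (Yhat b) : ℤ)
        - (LagrangianPath.compIndex (Y a) (Yhat a) : ℤ) ∧
    LagrangianPath.dualOscNumber a b Y - LagrangianPath.dualOscNumber a b Yhat =
      (LagrangianPath.dualCompIndex (Y a) (Yhat a) : ℤ)
        - (LagrangianPath.dualCompIndex (Y b) (Yhat b) : ℤ) := by
  obtain ⟨C, hC, hYC⟩ := hY
  obtain ⟨K, hK, hYK⟩ := hYhat
  have hcont : ∀ M : Matrix (Fin n ⊕ Fin n) (Fin n) ℝ,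
      ContinuousOn (fun t => Φ t * M) (Set.Icc a b) := fun M =>
    (show Continuous fun S : Matrix (Fin n ⊕ Fin n) (Fin n ⊕ Fin n) ℝ => S * M by
      fun_prop).comp_continuousOn hΦ
  have hYc : ContinuousOn Y (Set.Icc a b) := (hcont C).congr hYC
  have hZc : ContinuousOn Yhat (Set.Icc a b) := (hcont K).congr hYK
  have hYL : ∀ t ∈ Set.Icc a b, IsLagrangian (Y t) := fun t ht => by
    rw [hYC t ht]; exact hC.symplectic_mul (hΦs t ht)
  have hZL : ∀ t ∈ Set.Icc a b, IsLagrangian (Yhat t) := fun t ht => by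
    rw [hYK t ht]; exact hK.symplectic_mul (hΦs t ht)
  have hwY := oscWellDefined hab hYc hYL
  have hwZ := oscWellDefined hab hZc hZL
  obtain ⟨D, hD⟩ := hwY.1
  obtain ⟨D', hD'⟩ := hwZ.1
  -- Symplectic matrices preserve the Wronskian, so it is the constant `W(C, K)`.
  have hW : ∃ r : ℕ, ∀ t ∈ Set.Icc a b, (wronskian (Y t) (Yhat t)).rank = r :=
    ⟨_, fun t ht => by rw [hYC t ht, hYK t ht, wronskian_mul_mul (hΦs t ht)]⟩
  refine ⟨hwY, hwZ, ?_, ?_⟩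
  · have h := signedSum_sub_signedSum (ε := 1) (by norm_num) hab.le hYc hYL hZc hZL hW hD hD'
    rw [OscSystem.signedSum_one, OscSystem.signedSum_one] at h
    rw [← (hwY.2 D hD).1, ← (hwZ.2 D' hD').1, h]
    simp only [signedIndex_one]
  · have h := signedSum_sub_signedSum (ε := -1) (by norm_num) hab.le hYc hYL hZc hZL hW hD hD'
    rw [OscSystem.signedSum_neg_one, OscSystem.signedSum_neg_one] at h
    simp only [signedIndex_neg_one] at h
    rw [← (hwY.2 D hD).2, ← (hwZ.2 D' hD').2]
    linarith
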